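/- Let $d\ge 1$ be an integer. Let $M_b(\mathbb{R}^d)$ be the space of finite real-valued Radon measures on $\mathbb{R}^d$, and for $a\in M_b(\mathbb{R}^d)$, $t>0$, let $e^{t\Delta}a(x)=\int (4\pi t)^{-d/2}e^{-|x-y|^2/(4t)}\,da(y)$. For $\beta\in(0,d]$, a measure $a\in M_b(\mathbb{R}^d)$ is a $\beta$-atom if there is a cube $Q$ with sides parallel to the coordinate axes and side length $l(Q)>0$ such that $\operatorname{supp}a\subset Q$, $a(Q)=0$, $\sup_{x\in\mathbb{R}^d,\,t>0}|t^{(d-\beta)/2}e^{t\Delta}a(x)|\le l(Q)^{-\beta}$ and $|a|(\mathbb{R}^d)\le 1$. The space $DS_\beta(\mathbb{R}^d)$ consists of all $\mu\in M_b(\mathbb{R}^d)$ for which there are $\beta$-atoms $a_{i,n}$ and real numbers $\lambda_{i,n}$ with $$\int\varphi\,d\mu=\lim_{n\to\infty}\sum_{i=1}^n\lambda_{i,n}\int\varphi\,da_{i,n}\quad\text{for all }\varphi\in C_0(\mathbb{R}^d),\qquad \limsup_{n\to\infty}\sum_{i=1}^n|\lambda_{i,n}|<\infty,$$ and $\|\mu\|_{DS_\beta(\mathbb{R}^d)}$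 is the infimum of $\limsup_{n\to\infty}\sum_{i=1}^n|\lambda_{i,n}|$ over all such representations. For a finite set $\mathcal{F}\subset\mathbb{Z}_{\ge0}\times\mathbb{Z}_{\ge0}$ and a Schwartz function $\Phi$ put $\|\Phi\|_{\mathcal{F}}=\max_{(k,m)\in\mathcal{F}}\sup_{x}|x|^k\,\|D^m\Phi(x)\|$, and let $\Phi_t(x)=t^{-d}\Phi(x/t)$. For $\gamma\in[0,d]$ the fractional grand maximal function of $\mu\in M_b(\mathbb{R}^d)$ is $$\mathrm{M}_{\mathcal{F},\gamma}\mu(x)=\sup\{\,t^\gamma|\mu*\Phi_t(x)| : t>0,\ \Phi\in\mathcal{S}(\mathbb{R}^d),\ \|\Phi\|_{\mathcal{F}}\le1\,\}\in[0,\infty].$$ Let $\mathcal{H}^\beta_\infty(E)=\inf\{\sum_{i=1}^\infty\omega_\beta r_i^\beta : E\subset\bigcup_{i=1}^\infty B(x_i,r_i)\}$, with $\omega_\beta=\pi^{\beta/2}/\Gamma(\beta/2+1)$, be the spherical Hausdorff content, and for $f:\mathbb{R}^d\to[0,\infty]$ let $$\|f\|_{L^1(\mathcal{H}^\beta_\infty)}=\int_{\mathbb{R}^d}f\,d\mathcal{H}^\beta_\infty=\int_0^\infty\mathcal{H}^\beta_\infty(\{x: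 f(x)>t\})\,dt .$$ Then there is a finite set $\mathcal{F}_0\subset\mathbb{Z}_{\ge0}\times\mathbb{Z}_{\ge0}$, depending only on $d$, such that for every $\beta\in(0,d]$ there exists a constant $C=C(\beta,d)>0$ with $$\|\mathrm{M}_{\mathcal{F},d-\beta}\,\mu\|_{L^1(\mathcal{H}^\beta_\infty)}\le C\,\|\mu\|_{DS_\beta(\mathbb{R}^d)}$$ for all finite $\mathcal{F}\supset\mathcal{F}_0$ and all $\mu\in DS_\beta(\mathbb{R}^d)$. -/

import Mathlib

open MeasureTheory Filter Topology
open scoped ENNReal NNReal SchwartzMap ZeroAtInfty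

noncomputable section

namespace DimStable

/-- The Euclidean space `ℝ^d`. -/
abbrev Space (d : ℕ) : Type := EuclideanSpace ℝ (Fin d)

/-- The space `M_b(ℝ^d)` of finite (real-valued) Radon measures on `ℝ^d`; every finite signed Borel
measure on `ℝ^d` is Radon. -/
abbrev FinRadon (d : ℕ) : Type := SignedMeasure (Space d)

variable {d : ℕ}

/-- The closed cube with sides parallel to the axes, with lower corner `c` and side length `ℓ`. -/
def cube (c : Space d) (ℓ : ℝ) : Set (Space d) :=
  {x | ∀ j, x j ∈ Set.Icc (c j) (c j + ℓ)}

/-- The heat extension `e^{tΔ} a (x) = ∫ (4πt)^{-d/2} exp(-|x-y|²/(4t)) da(y)`. -/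
def heatExt (a : FinRadon d) (t : ℝ) (x : Space d) : ℝ :=
  ∫ᵛ y, (4 * Real.pi * t) ^ (-(d : ℝ) / 2) * Real.exp (-‖x - y‖ ^ 2 / (4 * t)) ∂•a

/-- `a` is a `β`-atom: for some cube `Q` with side length `ℓ > 0` and sides parallel to the axes,
`supp a ⊆ Q`, `a(Q) = 0`, `|t^{(d-β)/2} e^{tΔ}a(x)| ≤ ℓ^{-β}` for all `x` and `t > 0`, and
`|a|(ℝ^d) ≤ 1`. As `Q` is closed, `supp a ⊆ Q` means that `|a|` does not charge the complement
of `Q`. -/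
def IsAtom (β : ℝ) (a : FinRadon d) : Prop :=
  ∃ (c : Space d) (ℓ : ℝ), 0 < ℓ ∧
    a.totalVariation (cube c ℓ)ᶜ = 0 ∧
    a (cube c ℓ) = 0 ∧
    (∀ (x : Space d) (t : ℝ), 0 < t → |t ^ (((d : ℝ) - β) / 2) * heatExt a t x| ≤ 1 / ℓ ^ β) ∧
    a.totalVariation Set.univ ≤ 1

/-- `μ = lim_{n → ∞} ∑_{i=1}^n c_{i,n} a_{i,n}` weakly-star as measures (against `C₀(ℝ^d)`), with
`β`-atoms `a_{i,n}` and real coefficients `c_{i,n}`. The pair `(i, n)` is written `n i`, with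
`i = 0, …, n - 1`. -/
def IsAtomicLimit (β : ℝ) (μ : FinRadon d) (c : ℕ → ℕ → ℝ) (a : ℕ → ℕ → FinRadon d) : Prop :=
  (∀ n, ∀ i < n, IsAtom β (a n i)) ∧
    ∀ φ : C₀(Space d, ℝ),
      Tendsto (fun n => ∑ i ∈ Finset.range n, c n i * ∫ᵛ x, φ x ∂•(a n i)) atTop
        (𝓝 (∫ᵛ x, φ x ∂•μ))

/-- `limsup_{n → ∞} ∑_{i=1}^n |c_{i,n}|`, in `[0, ∞]`. -/
def coeffLimsup (c : ℕ → ℕ → ℝ) : ℝ≥0∞ :=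
  limsup (fun n => ∑ i ∈ Finset.range n, ENNReal.ofReal |c n i|) atTop

/-- The atomic space `DS_β(ℝ^d)`. -/
def DS (d : ℕ) (β : ℝ) : Set (FinRadon d) :=
  {μ | ∃ (c : ℕ → ℕ → ℝ) (a : ℕ → ℕ → FinRadon d), IsAtomicLimit β μ c a ∧ coeffLimsup c < ∞}

/-- The norm `‖μ‖_{DS_β(ℝ^d)}`, with value `∞` when `μ` has no representation. -/
def dsNorm (β : ℝ) (μ : FinRadon d) : ℝ≥0∞ :=
  ⨅ (c : ℕ → ℕ → ℝ) (a : ℕ → ℕ → FinRadon d) (_ : IsAtomicLimit β μ c a), coeffLimsup c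

/-- `(μ * Φ_t)(x) = ∫ t^{-d} Φ((x - y)/t) dμ(y)`, where `Φ_t(x) = t^{-d} Φ(x/t)`. -/
def convDilate (μ : FinRadon d) (Φ : 𝓢(Space d, ℝ)) (t : ℝ) (x : Space d) : ℝ :=
  ∫ᵛ y, (t ^ d)⁻¹ * Φ (t⁻¹ • (x - y)) ∂•μ

/-- The fractional grand maximal function
`M_{F,γ} μ (x) = sup { t^γ |(μ * Φ_t)(x)| : t > 0, ‖Φ‖_F ≤ 1 }`. The finite set `F` of pairs `(k, m)`
stands for the Schwartz seminorms `sup_x |x|^k |D^m Φ(x)|`, and `‖Φ‖_F` is their maximum over `F`. -/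
def grandMaximal (F : Finset (ℕ × ℕ)) (γ : ℝ) (μ : FinRadon d) (x : Space d) : ℝ≥0∞ :=
  ⨆ (Φ : 𝓢(Space d, ℝ)) (_ : F.sup (schwartzSeminormFamily ℝ (Space d) ℝ) Φ ≤ 1)
    (t : ℝ) (_ : 0 < t), ENNReal.ofReal (t ^ γ * |convDilate μ Φ t x|)

/-- `ω_β = π^{β/2} / Γ(β/2 + 1)`. -/
def omega (β : ℝ) : ℝ := Real.pi ^ (β / 2) / Real.Gamma (β / 2 + 1)

/-- The spherical Hausdorff content `H^β_∞` (for `β > 0`; balls of radius `0` are empty and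
contribute `0`, so that finite coverings are included). -/
def hausdorffContent (β : ℝ) (S : Set (Space d)) : ℝ≥0∞ :=
  ⨅ (x : ℕ → Space d) (r : ℕ → ℝ≥0) (_ : S ⊆ ⋃ i, Metric.ball (x i) (r i)),
    ∑' i, ENNReal.ofReal (omega β * (r i : ℝ) ^ β)

/-- The Choquet integral `∫ f dH^β_∞ = ∫_0^∞ H^β_∞({f > t}) dt` of `f : ℝ^d → [0, ∞]`, which is the
(quasi-)norm of `L¹(H^β_∞)`. -/
def choquetIntegral (β : ℝ) (f : Space d → ℝ≥0∞) : ℝ≥0∞ :=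
  ∫⁻ t in Set.Ioi (0 : ℝ), hausdorffContent β {x | ENNReal.ofReal t < f x}

end DimStable

end

/-! The proof bounds the maximal function of a single atom uniformly and carries that bound through
sums and weak-star limits.

Sums and limits. Subadditivity of a Choquet integral rests on strong subadditivity of the content,
so `hausdorffContent` is replaced by the dyadic content, which dominates it up to a constant
(`hausdorffContent_le_dyadicContent`). Dyadic cubes are nested or disjoint; this makes the dyadic
content strongly subadditive and continuous from below (`IsWeightedForest.isCapacity`). Its Choquet
integral therefore respects sums of weighted indicators (`choquet_sum_tsum_indicator_le`) and
satisfies Fatou's lemma (`choquet_liminf_le`). Each `Φ_t(x - ·)` belongs to `C₀`, so the maximal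
function of a weak-star limit is at most the liminf of the weighted sums of the maximal functions of
the atoms (`grandMaximal_le_liminf`).

One atom on a cube of side `l`. At distance about `ρ ≥ d * l`, the vanishing mean and the decay of
`∇Φ` give a bound of order `l * ρ ^ (-(β + 1))` (`abs_convDilate_far`). Near the cube a bound of
order `l ^ (-β)` must come from the heat extension alone. To this end `Φ_t` is expanded as a series
of Gaussian averages at the scales `t / 4 ^ j`: each step subtracts from the current remainder its
own average. Pairing an average with the atom amounts to integrating the remainder against the heat
extension. With `d + 1` derivatives of `Φ` in `L¹`, the remainders decay like `2 ^ j / 4 ^ (j * (d +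
1))`, which beats the loss of at most `4 ^ (j * d)` from small times for every `β` in `(0, d]`;
hence seminorms depending on `d` only (`abs_vectorIntegral_le_of_heatExt_le`). Balls of radius about
`2 ^ k * l` have content of order `(2 ^ k * l) ^ β` (`dyadicContent_ball_le`), so the dyadic shells
contribute a geometric series. -/

namespace DimStable

/-! ### Contents generated by a forest of sets: strong subadditivity and continuity from below -/

section TreeContent

variable {ι X : Type*}

/-- A laminar family of sets, ordered like a forest, with weights such that only finitely many
members of bounded weight lie above a given one. -/
structure IsWeightedForest [PartialOrder ι] (S : ι → Set X) (w : ι → ℝ≥0∞) : Prop where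
  mono : Monotone S
  comparable : ∀ {p q : ι} {x : X}, x ∈ S p → x ∈ S q → p ≤ q ∨ q ≤ p
  finite_above : ∀ (p : ι) {M : ℝ≥0∞}, M < ∞ → {q | p ≤ q ∧ w q ≤ M}.Finite

/-- The total weight of a family. -/
noncomputable def familyCost (w : ι → ℝ≥0∞) (A : Set ι) : ℝ≥0∞ := ∑' q, A.indicator w q

/-- The content of a set: the infimum of the total weights of its covers. -/
noncomputable def forestContent (S : ι → Set X) (w : ι → ℝ≥0∞) (E : Set X) : ℝ≥0∞ :=
  ⨅ (A : Set ι) (_ : E ⊆ ⋃ q ∈ A, S q), familyCost w A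

/-- A cover of the union of what is covered by two families. -/
def joinCover [PartialOrder ι] (A B : Set ι) : Set ι :=
  {p | p ∈ A ∧ ∀ q ∈ B, ¬ p ≤ q} ∪ {p | p ∈ B ∧ ∀ q ∈ A, ¬ p < q}

/-- A cover of the intersection of what is covered by two families. -/
def meetCover [PartialOrder ι] (A B : Set ι) : Set ι :=
  {p | p ∈ A ∧ ∃ q ∈ B, p ≤ q} ∪ {p | p ∈ B ∧ ∃ q ∈ A, p < q}

/-- The inequality holds member by member. A member of only one family enters exactly one of the two
new covers, according to whether something of the other family lies above it. A common member is
already counted twice on the right; the strict order in one clause keeps a maximal common member in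
the join. -/
theorem familyCost_join_add_meet_le [PartialOrder ι] (w : ι → ℝ≥0∞) (A B : Set ι) :
    familyCost w (joinCover A B) + familyCost w (meetCover A B) ≤
      familyCost w A + familyCost w B := by
  classical
  unfold familyCost
  rw [← ENNReal.tsum_add, ← ENNReal.tsum_add]
  refine ENNReal.tsum_le_tsum fun q => ?_
  by_cases hA : q ∈ A <;> by_cases hB : q ∈ B
  · simp only [Set.indicator_of_mem hA, Set.indicator_of_mem hB]
    exact add_le_add (Set.indicator_le_self' (fun _ _ => zero_le) _)
      (Set.indicator_le_self' (fun _ _ => zero_le) _)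
  · by_cases h : ∃ q' ∈ B, q ≤ q'
    · have : q ∉ joinCover A B := by
        rintro (⟨_, h'⟩ | ⟨h', _⟩)
        · obtain ⟨q', hq', hle⟩ := h
          exact h' q' hq' hle
        · exact hB h'
      simp only [Set.indicator_of_mem hA, Set.indicator_of_notMem hB,
        Set.indicator_of_notMem this, zero_add, add_zero]
      exact Set.indicator_le_self' (fun _ _ => zero_le) _
    · have : q ∉ meetCover A B := by
        rintro (⟨_, h'⟩ | ⟨h', _⟩)
        · exact h h'
        · exact hB h'
      simp only [Set.indicator_of_mem hA, Set.indicator_of_notMem hB,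
        Set.indicator_of_notMem this, add_zero]
      exact Set.indicator_le_self' (fun _ _ => zero_le) _
  · by_cases h : ∃ q' ∈ A, q < q'
    · have : q ∉ joinCover A B := by
        rintro (⟨h', _⟩ | ⟨_, h'⟩)
        · exact hA h'
        · obtain ⟨q', hq', hle⟩ := h
          exact h' q' hq' hle
      simp only [Set.indicator_of_mem hB, Set.indicator_of_notMem hA,
        Set.indicator_of_notMem this, zero_add]
      exact Set.indicator_le_self' (fun _ _ => zero_le) _
    · have : q ∉ meetCover A B := by
        rintro (⟨h', _⟩ | ⟨_, h'⟩)
        · exact hA h'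
        · exact h h'
      simp only [Set.indicator_of_mem hB, Set.indicator_of_notMem hA,
        Set.indicator_of_notMem this, add_zero, zero_add]
      exact Set.indicator_le_self' (fun _ _ => zero_le) _
  · have h1 : q ∉ joinCover A B := by
      rintro (⟨h', _⟩ | ⟨h', _⟩)
      exacts [hA h', hB h']
    have h2 : q ∉ meetCover A B := by
      rintro (⟨h', _⟩ | ⟨h', _⟩)
      exacts [hA h', hB h']
    simp [Set.indicator_of_notMem h1, Set.indicator_of_notMem h2]

theorem weight_le_familyCost {w : ι → ℝ≥0∞} {A : Set ι} {q : ι} (hq : q ∈ A) :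
    w q ≤ familyCost w A := by
  classical
  calc w q = A.indicator w q := by rw [Set.indicator_of_mem hq]
    _ ≤ _ := ENNReal.le_tsum q

variable {S : ι → Set X} {w : ι → ℝ≥0∞}

theorem forestContent_le_cost {E : Set X} {A : Set ι} (h : E ⊆ ⋃ q ∈ A, S q) :
    forestContent S w E ≤ familyCost w A := iInf₂_le A h

theorem forestContent_mono {E F : Set X} (h : E ⊆ F) :
    forestContent S w E ≤ forestContent S w F :=
  le_iInf₂ fun _ hA => forestContent_le_cost (h.trans hA)

theorem forestContent_empty : forestContent S w ∅ = 0 := by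
  refine le_antisymm ((forestContent_le_cost (A := ∅) (by simp)).trans ?_) zero_le
  simp [familyCost]

theorem exists_cover_lt {E : Set X} {M : ℝ≥0∞} (h : forestContent S w E < M) :
    ∃ A : Set ι, E ⊆ ⋃ q ∈ A, S q ∧ familyCost w A < M := by
  simpa [forestContent, iInf_lt_iff] using h

namespace IsWeightedForest

variable [PartialOrder ι]

/-- Members of finite-cost families have bounded weight, so only finitely many lie above `p`, and a
maximal one survives in the join. -/
theorem exists_mem_joinCover (hS : IsWeightedForest S w) {A B : Set ι} (hA : familyCost w A < ∞) (hB : familyCost w B < ∞)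
    {p : ι} (hp : p ∈ A ∪ B) : ∃ q ∈ joinCover A B, p ≤ q := by
  have hM : familyCost w A + familyCost w B < ∞ := ENNReal.add_lt_top.2 ⟨hA, hB⟩
  have hw : ∀ q ∈ A ∪ B, w q ≤ familyCost w A + familyCost w B := by
    rintro q (hq | hq)
    · exact (weight_le_familyCost hq).trans le_self_add
    · exact (weight_le_familyCost hq).trans le_add_self
  have hfin : {q | p ≤ q ∧ q ∈ A ∪ B}.Finite :=
    (hS.finite_above p hM).subset fun q hq => ⟨hq.1, hw q hq.2⟩
  obtain ⟨q, hpq, hmax⟩ := hfin.exists_le_maximal (a := p) ⟨le_rfl, hp⟩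
  have hq := hmax.prop
  have hmax' : ∀ q' ∈ A ∪ B, q ≤ q' → q' = q := fun q' hq' hle =>
    le_antisymm (hmax.2 ⟨hq.1.trans hle, hq'⟩ hle) hle
  refine ⟨q, ?_, hpq⟩
  by_cases hqB : q ∈ B
  · exact Or.inr ⟨hqB, fun q' hq' hlt => hlt.ne' (hmax' q' (Or.inl hq') hlt.le)⟩
  · refine Or.inl ⟨hq.2.resolve_right hqB, fun q' hq' hle => hqB ?_⟩
    rwa [← hmax' q' (Or.inr hq') hle]

theorem subset_joinCover (hS : IsWeightedForest S w) {A B : Set ι} (hA : familyCost w A < ∞) (hB : familyCost w B < ∞) :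
    (⋃ q ∈ A, S q) ∪ (⋃ q ∈ B, S q) ⊆ ⋃ q ∈ joinCover A B, S q := by
  intro x hx
  obtain ⟨p, hp, hxp⟩ : ∃ p ∈ A ∪ B, x ∈ S p := by
    rcases hx with hx | hx
    all_goals
      obtain ⟨p, hp, hx⟩ := Set.mem_iUnion₂.1 hx
    exacts [⟨p, Or.inl hp, hx⟩, ⟨p, Or.inr hp, hx⟩]
  obtain ⟨q, hq, hle⟩ := hS.exists_mem_joinCover hA hB hp
  exact Set.mem_iUnion₂.2 ⟨q, hq, hS.mono hle hxp⟩

theorem subset_meetCover (hS : IsWeightedForest S w) (A B : Set ι) :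
    (⋃ q ∈ A, S q) ∩ (⋃ q ∈ B, S q) ⊆ ⋃ q ∈ meetCover A B, S q := by
  rintro x ⟨hxA, hxB⟩
  obtain ⟨p, hp, hxp⟩ := Set.mem_iUnion₂.1 hxA
  obtain ⟨q, hq, hxq⟩ := Set.mem_iUnion₂.1 hxB
  by_cases hpq : p ≤ q
  · exact Set.mem_iUnion₂.2 ⟨p, Or.inl ⟨hp, q, hq, hpq⟩, hxp⟩
  · have hqp := (hS.comparable hxp hxq).resolve_left hpq
    exact Set.mem_iUnion₂.2
      ⟨q, Or.inr ⟨hq, p, hp, lt_of_le_of_ne hqp fun h => hpq h.ge⟩, hxq⟩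

theorem content_union_add_inter_le (hS : IsWeightedForest S w) (E F : Set X) :
    forestContent S w (E ∪ F) + forestContent S w (E ∩ F) ≤
      forestContent S w E + forestContent S w F := by
  refine ENNReal.le_of_forall_pos_le_add fun ε hε hfin => ?_
  have hE : forestContent S w E ≠ ∞ := (le_self_add.trans_lt hfin).ne
  have hF : forestContent S w F ≠ ∞ := (le_add_self.trans_lt hfin).ne
  have hε' : ((ε / 2 : ℝ≥0) : ℝ≥0∞) ≠ 0 := by
    simpa using hε.ne'
  obtain ⟨A, hEA, hA⟩ := exists_cover_lt (ENNReal.lt_add_right hE hε')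
  obtain ⟨B, hFB, hB⟩ := exists_cover_lt (ENNReal.lt_add_right hF hε')
  have h1 : E ∪ F ⊆ ⋃ q ∈ joinCover A B, S q :=
    (Set.union_subset_union hEA hFB).trans
      (hS.subset_joinCover hA.lt_top hB.lt_top)
  have h2 : E ∩ F ⊆ ⋃ q ∈ meetCover A B, S q :=
    (Set.inter_subset_inter hEA hFB).trans (hS.subset_meetCover A B)
  calc _ ≤ familyCost w (joinCover A B) + familyCost w (meetCover A B) :=
        add_le_add (forestContent_le_cost h1) (forestContent_le_cost h2)
    _ ≤ familyCost w A + familyCost w B := familyCost_join_add_meet_le w A B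
    _ ≤ _ := add_le_add hA.le hB.le
    _ = forestContent S w E + forestContent S w F + ((ε / 2 + ε / 2 : ℝ≥0) : ℝ≥0∞) := by
        push_cast; ring
    _ = _ := by rw [add_halves]

/-- Near-optimal covers of the `E n` are joined successively, which makes the covers grow along
chains; strong subadditivity keeps the accumulated excess summable. Chains of bounded weight
stabilise, so the members that are eventually present cover the union. -/
theorem content_iUnion_of_monotone (hS : IsWeightedForest S w) {E : ℕ → Set X} (hE : Monotone E) :
    forestContent S w (⋃ n, E n) = ⨆ n, forestContent S w (E n) := by
  refine le_antisymm ?_ (iSup_le fun n => forestContent_mono (Set.subset_iUnion E n))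
  refine ENNReal.le_of_forall_pos_le_add fun ε hε hfin => ?_
  set c := ⨆ n, forestContent S w (E n) with hc
  obtain ⟨δ, hδ, hδsum⟩ := ENNReal.exists_pos_sum_of_countable (ι := ℕ)
    (ENNReal.coe_ne_zero.2 hε.ne')
  have hle : ∀ n, forestContent S w (E n) ≤ c := fun n => le_iSup (fun n => forestContent S w (E n)) n
  have hcov : ∀ n, ∃ A : Set ι, E n ⊆ ⋃ q ∈ A, S q ∧
      familyCost w A < forestContent S w (E n) + δ n := fun n =>
    exists_cover_lt (ENNReal.lt_add_right ((hle n).trans_lt hfin).ne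
      (ENNReal.coe_ne_zero.2 (hδ n).ne'))
  choose A hEA hA using hcov
  have hAtop : ∀ n, familyCost w (A n) < ∞ := fun n => (hA n).trans_le le_top
  let J : ℕ → Set ι := fun n => Nat.rec (A 0) (fun n J => joinCover J (A (n + 1))) n
  have hJsucc : ∀ n, J (n + 1) = joinCover (J n) (A (n + 1)) := fun n => rfl
  have hJ : ∀ n, E n ⊆ ⋃ q ∈ J n, S q ∧
      familyCost w (J n) ≤ forestContent S w (E n) + ∑ k ∈ Finset.range (n + 1), (δ k : ℝ≥0∞) := by
    intro n
    induction n with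
    | zero => exact ⟨hEA 0, by rw [zero_add, Finset.sum_range_one]; exact (hA 0).le⟩
    | succ n ih =>
      obtain ⟨ih1, ih2⟩ := ih
      have hJn : familyCost w (J n) < ∞ := ih2.trans_lt
        (ENNReal.add_lt_top.2 ⟨(hle n).trans_lt hfin, by simp [ENNReal.sum_lt_top]⟩)
      rw [hJsucc]
      refine ⟨((hEA (n + 1)).trans Set.subset_union_right).trans
        (hS.subset_joinCover hJn (hAtop (n + 1))), ?_⟩
      -- The meet still covers `E n`, so its cost cancels the content of `E n` in the bound for `J
      -- n`; only the errors accumulate.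
      have hmeet : forestContent S w (E n) ≤ familyCost w (meetCover (J n) (A (n + 1))) :=
        forestContent_le_cost ((Set.subset_inter ih1 ((hE n.le_succ).trans (hEA (n + 1)))).trans
          (hS.subset_meetCover _ _))
      have hne : forestContent S w (E n) ≠ ∞ := ((hle n).trans_lt hfin).ne
      refine (ENNReal.add_le_add_iff_right hne).1 ?_
      calc familyCost w (joinCover (J n) (A (n + 1))) + forestContent S w (E n)
          ≤ familyCost w (J n) + familyCost w (A (n + 1)) :=
            (add_le_add le_rfl hmeet).trans (familyCost_join_add_meet_le _ _ _)
        _ ≤ (forestContent S w (E n) + ∑ k ∈ Finset.range (n + 1), (δ k : ℝ≥0∞)) +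
            (forestContent S w (E (n + 1)) + δ (n + 1)) := add_le_add ih2 (hA _).le
        _ = _ := by rw [Finset.sum_range_succ _ (n + 1)]; ring
  have hJcost : ∀ n, familyCost w (J n) ≤ c + ε := fun n =>
    (hJ n).2.trans (add_le_add (hle n) ((ENNReal.sum_le_tsum _).trans hδsum.le))
  have htop : c + ε < ∞ := ENNReal.add_lt_top.2 ⟨hfin, ENNReal.coe_lt_top⟩
  let L : Set ι := {q | ∀ᶠ n in atTop, q ∈ J n}
  have hLcover : (⋃ n, E n) ⊆ ⋃ q ∈ L, S q := by
    intro x hx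
    obtain ⟨m, hm⟩ := Set.mem_iUnion.1 hx
    obtain ⟨p, hp, hxp⟩ := Set.mem_iUnion₂.1 ((hJ m).1 hm)
    have hstep : ∀ n, ∀ q ∈ J n, ∃ q' ∈ J (n + 1), q ≤ q' := fun n q hq =>
      hS.exists_mem_joinCover ((hJcost n).trans_lt htop) (hAtop _) (Or.inl hq)
    choose! next hnext hle_next using hstep
    let s : ℕ → ι := fun k => Nat.rec p (fun k q => next (m + k) q) k
    have hsmem : ∀ k, s k ∈ J (m + k) := by
      intro k
      induction k with
      | zero => exact hp
      | succ k ih => exact hnext (m + k) _ ih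
    have hsmono : Monotone s := monotone_nat_of_le_succ fun k => hle_next (m + k) _ (hsmem k)
    have hfinrange : (Set.range s).Finite := by
      refine (hS.finite_above p htop).subset ?_
      rintro _ ⟨k, rfl⟩
      exact ⟨hsmono (Nat.zero_le k), (weight_le_familyCost (hsmem k)).trans (hJcost _)⟩
    obtain ⟨q, hq, hqmax⟩ := hfinrange.exists_maximal ⟨s 0, 0, rfl⟩
    obtain ⟨k, rfl⟩ := hq
    have hconst : ∀ j, k ≤ j → s j = s k := fun j hj =>
      le_antisymm (hqmax ⟨j, rfl⟩ (hsmono hj)) (hsmono hj)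
    refine Set.mem_iUnion₂.2 ⟨s k, ?_, hS.mono (hsmono (Nat.zero_le k)) hxp⟩
    refine eventually_atTop.2 ⟨m + k, fun n hn => ?_⟩
    obtain ⟨j, rfl⟩ := Nat.exists_eq_add_of_le (le_of_add_le_left hn)
    rw [← hconst j (by omega)]
    exact hsmem j
  refine (forestContent_le_cost hLcover).trans ?_
  unfold familyCost
  rw [ENNReal.tsum_eq_iSup_sum]
  refine iSup_le fun s => ?_
  classical
  -- Fatou for the cost: a finite part of `L` is contained in a single `J n`.
  have hev : ∀ᶠ n in atTop, ∀ q ∈ s, L.indicator w q ≤ (J n).indicator w q := by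
    rw [Finset.eventually_all]
    intro q _
    by_cases hq : q ∈ L
    · filter_upwards [show ∀ᶠ n in atTop, q ∈ J n from hq] with n hn
      rw [Set.indicator_of_mem hq, Set.indicator_of_mem hn]
    · exact Eventually.of_forall fun n => by simp [Set.indicator_of_notMem hq]
  obtain ⟨n, hn⟩ := hev.exists
  exact (Finset.sum_le_sum hn).trans ((ENNReal.sum_le_tsum s).trans (hJcost n))

end IsWeightedForest

end TreeContent

/-! ### Choquet integrals for strongly subadditive set functions -/

section Choquet

variable {X : Type*}

/-- A monotone, strongly subadditive set function that is continuous from below. -/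
structure IsCapacity (h : Set X → ℝ≥0∞) : Prop where
  mono : Monotone h
  empty : h ∅ = 0
  union_add_inter_le : ∀ E F, h (E ∪ F) + h (E ∩ F) ≤ h E + h F
  iUnion : ∀ E : ℕ → Set X, Monotone E → h (⋃ n, E n) = ⨆ n, h (E n)

theorem IsWeightedForest.isCapacity {ι : Type*} [PartialOrder ι] {S : ι → Set X} {w : ι → ℝ≥0∞}
    (hS : IsWeightedForest S w) : IsCapacity (forestContent S w) where
  mono _ _ h := forestContent_mono h
  empty := forestContent_empty
  union_add_inter_le := hS.content_union_add_inter_le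
  iUnion _ := hS.content_iUnion_of_monotone

/-- The Choquet integral of a function with respect to a set function. -/
noncomputable def choquet (h : Set X → ℝ≥0∞) (f : X → ℝ≥0∞) : ℝ≥0∞ :=
  ∫⁻ t in Set.Ioi (0 : ℝ), h {x | ENNReal.ofReal t < f x}

namespace IsCapacity

variable {h : Set X → ℝ≥0∞}

theorem choquet_mono (hh : IsCapacity h) {f g : X → ℝ≥0∞} (hfg : f ≤ g) :
    choquet h f ≤ choquet h g :=
  lintegral_mono fun _ => hh.mono fun x hx => lt_of_lt_of_le hx (hfg x)

theorem choquet_zero (hh : IsCapacity h) : choquet h (fun _ => 0) = 0 := by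
  simp [choquet, hh.empty]

theorem measurable_levelSet (hh : IsCapacity h) (A : Set X) (f : X → ℝ≥0∞) :
    Measurable fun t : ℝ => h (A ∩ {x | ENNReal.ofReal t < f x}) := by
  refine Antitone.measurable fun s t hst => hh.mono (Set.inter_subset_inter_right A fun x hx => ?_)
  exact (ENNReal.ofReal_le_ofReal hst).trans_lt hx

/-- For `t < w` the new level set lies in `{f > t} ∪ A`; for `t ≥ w` it lies in `{f > t} ∪ (A ∩ {f >
t - w})`. Strong subadditivity leaves the term `h (A ∩ {f > t})` on the left, and its integral
cancels that of the shifted term on the right. Adding indicators one at a time is all the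
subadditivity that the atoms require. -/
theorem choquet_add_indicator_le (hh : IsCapacity h) (f : X → ℝ≥0∞) (w : ℝ≥0) (A : Set X) :
    choquet h (fun x => f x + A.indicator (fun _ => (w : ℝ≥0∞)) x) ≤
      choquet h f + w * h A := by
  classical
  by_cases hf : choquet h f = ∞
  · simp [hf]
  -- Finiteness is what permits the final cancellation.
  have hI : ∫⁻ t in Set.Ioi (0 : ℝ), h (A ∩ {x | ENNReal.ofReal t < f x}) ≠ ∞ :=
    ne_top_of_le_ne_top hf (lintegral_mono fun t => hh.mono Set.inter_subset_right)
  let H : ℝ → ℝ≥0∞ := fun t => if t < w then h A else h (A ∩ {x | ENNReal.ofReal (t - w) < f x})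
  have hpt : ∀ t ∈ Set.Ioi (0 : ℝ),
      h {x | ENNReal.ofReal t < f x + A.indicator (fun _ => (w : ℝ≥0∞)) x} +
        h (A ∩ {x | ENNReal.ofReal t < f x}) ≤
      h {x | ENNReal.ofReal t < f x} + H t := by
    intro t ht
    by_cases htw : t < w
    · simp only [H, if_pos htw]
      refine le_trans (add_le_add (hh.mono ?_) le_rfl)
        (le_trans (by rw [Set.inter_comm A]) (hh.union_add_inter_le {x | ENNReal.ofReal t < f x} A))
      intro x hx
      by_cases hxA : x ∈ A
      · exact Or.inr hxA
      · left
        simpa [hxA] using hx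
    · simp only [H, if_neg htw]
      have hlev : {x | ENNReal.ofReal t < f x + A.indicator (fun _ => (w : ℝ≥0∞)) x} ⊆
          {x | ENNReal.ofReal t < f x} ∪ (A ∩ {x | ENNReal.ofReal (t - w) < f x}) := by
        intro x hx
        by_cases hxA : x ∈ A
        · right
          refine ⟨hxA, ?_⟩
          rw [Set.mem_ofPred_eq, Set.indicator_of_mem hxA] at hx
          rw [Set.mem_ofPred_eq]
          have hsplit : ENNReal.ofReal t = ENNReal.ofReal (t - w) + w := by
            rw [← ENNReal.ofReal_coe_nnreal, ← ENNReal.ofReal_add (by linarith) w.coe_nonneg]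
            congr 1; ring
          rw [hsplit] at hx
          exact (ENNReal.add_lt_add_iff_right ENNReal.coe_ne_top).1 hx
        · left
          simpa [hxA] using hx
      refine le_trans (add_le_add (hh.mono hlev) (hh.mono ?_)) (hh.union_add_inter_le _ _)
      rintro x ⟨hxA, hx⟩
      exact ⟨hx, hxA, (ENNReal.ofReal_le_ofReal (by linarith [w.coe_nonneg])).trans_lt hx⟩
  have hmeas : Measurable fun t : ℝ => h (A ∩ {x | ENNReal.ofReal t < f x}) :=
    hh.measurable_levelSet A f
  have hmeasf : Measurable fun t : ℝ => h {x | ENNReal.ofReal t < f x} := by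
    simpa using hh.measurable_levelSet Set.univ f
  have hH : ∫⁻ t in Set.Ioi (0 : ℝ), H t ≤
      w * h A + ∫⁻ t in Set.Ioi (0 : ℝ), h (A ∩ {x | ENNReal.ofReal t < f x}) := by
    have hunion : Set.Ioi (0 : ℝ) ⊆ Set.Ioc 0 (w : ℝ) ∪ Set.Ioi (w : ℝ) := by
      intro t ht
      rcases le_or_gt t w with h1 | h1
      exacts [Or.inl ⟨ht, h1⟩, Or.inr h1]
    refine (lintegral_mono_set hunion).trans ((lintegral_union_le _ _ _).trans (add_le_add ?_ ?_))
    · calc ∫⁻ t in Set.Ioc 0 (w : ℝ), H t ≤ ∫⁻ t in Set.Ioc 0 (w : ℝ), h A := by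
            refine lintegral_mono fun t => ?_
            simp only [H]
            split_ifs
            exacts [le_rfl, hh.mono Set.inter_subset_left]
        _ = w * h A := by simp [mul_comm]
    · calc ∫⁻ t in Set.Ioi (w : ℝ), H t
          = ∫⁻ t in Set.Ioi (w : ℝ), h (A ∩ {x | ENNReal.ofReal (t - w) < f x}) := by
            refine setLIntegral_congr_fun measurableSet_Ioi fun t ht => ?_
            simp only [H, if_neg (not_lt.2 (le_of_lt (Set.mem_Ioi.1 ht)))]
        _ = ∫⁻ t in (fun t : ℝ => t - w) ⁻¹' Set.Ioi (0 : ℝ),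
              h (A ∩ {x | ENNReal.ofReal (t - w) < f x}) := by simp
        _ ≤ _ := ((measurePreserving_sub_right volume (w : ℝ)).setLIntegral_comp_preimage
              measurableSet_Ioi hmeas).le
  refine (ENNReal.add_le_add_iff_right hI).1 ?_
  calc choquet h (fun x => f x + A.indicator (fun _ => (w : ℝ≥0∞)) x) +
        ∫⁻ t in Set.Ioi (0 : ℝ), h (A ∩ {x | ENNReal.ofReal t < f x})
      = ∫⁻ t in Set.Ioi (0 : ℝ),
          (h {x | ENNReal.ofReal t < f x + A.indicator (fun _ => (w : ℝ≥0∞)) x} +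
            h (A ∩ {x | ENNReal.ofReal t < f x})) := (lintegral_add_right _ hmeas).symm
    _ ≤ ∫⁻ t in Set.Ioi (0 : ℝ), (h {x | ENNReal.ofReal t < f x} + H t) :=
        setLIntegral_mono' measurableSet_Ioi hpt
    _ = choquet h f + ∫⁻ t in Set.Ioi (0 : ℝ), H t := lintegral_add_left hmeasf _
    _ ≤ choquet h f + (w * h A +
          ∫⁻ t in Set.Ioi (0 : ℝ), h (A ∩ {x | ENNReal.ofReal t < f x})) := add_le_add le_rfl hH
    _ = _ := by rw [add_assoc]

theorem choquet_iSup (hh : IsCapacity h) {f : ℕ → X → ℝ≥0∞} (hf : Monotone f) :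
    choquet h (⨆ n, f n) = ⨆ n, choquet h (f n) := by
  unfold choquet
  rw [← lintegral_iSup]
  · refine lintegral_congr fun t => ?_
    rw [← hh.iUnion]
    · congr 1
      ext x
      simp [lt_iSup_iff]
    · exact fun m n hmn x hx => lt_of_lt_of_le hx (hf hmn x)
  · intro n
    simpa using hh.measurable_levelSet Set.univ (f n)
  · exact fun m n hmn t => hh.mono fun x hx => lt_of_lt_of_le hx (hf hmn x)

/-- Fatou's lemma follows from monotone convergence, which continuity from below of `h` supplies. -/
theorem choquet_liminf_le (hh : IsCapacity h) (f : ℕ → X → ℝ≥0∞) :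
    choquet h (fun x => liminf (fun n => f n x) atTop) ≤
      liminf (fun n => choquet h (f n)) atTop := by
  have hrw : (fun x => liminf (fun n => f n x) atTop) = ⨆ n, ⨅ i ≥ n, f i := by
    ext x
    simp [liminf_eq_iSup_iInf_of_nat]
  rw [hrw, hh.choquet_iSup, liminf_eq_iSup_iInf_of_nat]
  · refine iSup_mono fun n => le_iInf₂ fun i hi => hh.choquet_mono ?_
    exact iInf₂_le i hi
  · exact fun m n hmn => le_iInf₂ fun i hi => iInf₂_le i (hmn.trans hi)

theorem choquet_add_tsum_indicator_le (hh : IsCapacity h) (f : X → ℝ≥0∞) (w : ℕ → ℝ≥0)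
    (A : ℕ → Set X) :
    choquet h (fun x => f x + ∑' k, (A k).indicator (fun _ => (w k : ℝ≥0∞)) x) ≤
      choquet h f + ∑' k, w k * h (A k) := by
  have hfin : ∀ n : ℕ, choquet h (fun x => f x + ∑ k ∈ Finset.range n,
      (A k).indicator (fun _ => (w k : ℝ≥0∞)) x) ≤
      choquet h f + ∑ k ∈ Finset.range n, w k * h (A k) := by
    intro n
    induction n with
    | zero => simp
    | succ n ih =>
      simp only [Finset.sum_range_succ, ← add_assoc]
      exact (hh.choquet_add_indicator_le _ _ _).trans (add_le_add ih le_rfl)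
  have hrw : (fun x => f x + ∑' k, (A k).indicator (fun _ => (w k : ℝ≥0∞)) x) =
      ⨆ n, fun x => f x + ∑ k ∈ Finset.range n, (A k).indicator (fun _ => (w k : ℝ≥0∞)) x := by
    ext x
    rw [iSup_apply, ENNReal.tsum_eq_iSup_nat, ENNReal.add_iSup]
  rw [hrw, hh.choquet_iSup]
  · exact iSup_le fun n => (hfin n).trans (add_le_add le_rfl (ENNReal.sum_le_tsum _))
  · intro m n hmn x
    exact add_le_add le_rfl (Finset.sum_le_sum_of_subset (Finset.range_mono hmn))

theorem choquet_sum_tsum_indicator_le (hh : IsCapacity h) (n : ℕ) (w : ℕ → ℕ → ℝ≥0)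
    (A : ℕ → ℕ → Set X) :
    choquet h (fun x => ∑ i ∈ Finset.range n,
        ∑' k, (A i k).indicator (fun _ => (w i k : ℝ≥0∞)) x) ≤
      ∑ i ∈ Finset.range n, ∑' k, w i k * h (A i k) := by
  induction n with
  | zero => simp [hh.choquet_zero]
  | succ n ih =>
    simp only [Finset.sum_range_succ]
    exact (hh.choquet_add_tsum_indicator_le _ _ _).trans (add_le_add ih le_rfl)

end IsCapacity

end Choquet

/-! ### Dyadic cubes, and comparison of the dyadic content with balls -/

section Dyadic

variable {d : ℕ}

/-- Indices of dyadic cubes: the generation and the integer coordinates of the lower corner. -/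
structure DyadicCube (d : ℕ) where
  gen : ℤ
  corner : Fin d → ℤ

namespace DyadicCube

@[ext] theorem ext' {p q : DyadicCube d} (h : p.gen = q.gen) (h' : p.corner = q.corner) : p = q := by
  cases p; cases q; simp_all

/-- The half-open dyadic cube of side length `2 ^ (-gen)`. -/
def toSet (q : DyadicCube d) : Set (Space d) :=
  {x | ∀ j, ⌊(2 : ℝ) ^ q.gen * x j⌋ = q.corner j}

/-- The point of a dyadic cube with the least coordinates. -/
noncomputable def base (q : DyadicCube d) : Space d :=
  WithLp.toLp 2 fun j => (2 : ℝ) ^ (-q.gen) * q.corner j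

theorem base_mem (q : DyadicCube d) : q.base ∈ q.toSet := by
  intro j
  have h2 : (2 : ℝ) ^ q.gen * (2 : ℝ) ^ (-q.gen) = 1 := by
    rw [← zpow_add₀ two_ne_zero]; simp
  simp only [base]
  rw [← mul_assoc, h2, one_mul, Int.floor_intCast]

/-- Coarser cubes that contain a given cube are above it. -/
instance : PartialOrder (DyadicCube d) where
  -- The generation matters when `d = 0`: all cubes are then the same set, and inclusion alone is
  -- not antisymmetric.
  le p q := q.gen ≤ p.gen ∧ p.toSet ⊆ q.toSet
  le_refl p := ⟨le_rfl, subset_rfl⟩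
  le_trans p q r h h' := ⟨h'.1.trans h.1, h.2.trans h'.2⟩
  le_antisymm p q h h' := by
    have hg : p.gen = q.gen := le_antisymm h'.1 h.1
    refine ext' hg (funext fun j => ?_)
    have h1 := h.2 p.base_mem j
    rw [← hg, p.base_mem j] at h1
    exact h1

theorem le_of_mem {p q : DyadicCube d} {x : Space d} (hp : x ∈ p.toSet) (hq : x ∈ q.toSet)
    (h : q.gen ≤ p.gen) : p ≤ q := by
  refine ⟨h, fun y hy j => ?_⟩
  obtain ⟨n, hn⟩ := Int.eq_ofNat_of_zero_le (sub_nonneg.2 h)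
  have hpow : ∀ a : ℝ, (2 : ℝ) ^ q.gen * a = (2 : ℝ) ^ p.gen * a / ((2 ^ n : ℕ) : ℝ) := by
    intro a
    have : q.gen = p.gen - (n : ℤ) := by omega
    rw [this, zpow_sub₀ two_ne_zero, zpow_natCast]
    push_cast
    ring
  rw [← hq j, hpow, hpow, Int.floor_div_natCast, Int.floor_div_natCast, hy j, hp j]

/-- The `β`-dimensional weight of a dyadic cube. -/
noncomputable def weight (β : ℝ) (q : DyadicCube d) : ℝ≥0∞ :=
  ENNReal.ofReal (((2 : ℝ) ^ (-q.gen)) ^ β)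

theorem isWeightedForest {β : ℝ} (hβ : 0 < β) :
    IsWeightedForest (toSet : DyadicCube d → Set (Space d)) (weight β) where
  mono _ _ h := h.2
  comparable {p q x} hp hq := by
    rcases le_total q.gen p.gen with h | h
    exacts [Or.inl (le_of_mem hp hq h), Or.inr (le_of_mem hq hp h)]
  finite_above p M hM := by
    obtain ⟨N, hN⟩ : ∃ N : ℕ, M.toReal < ((2 : ℝ) ^ N) ^ β := by
      have h2 : (1 : ℝ) < 2 ^ β := Real.one_lt_rpow (by norm_num) hβ
      obtain ⟨N, hN⟩ := pow_unbounded_of_one_lt M.toReal h2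
      refine ⟨N, hN.trans_eq ?_⟩
      rw [← Real.rpow_natCast, ← Real.rpow_natCast, ← Real.rpow_mul (by norm_num),
        ← Real.rpow_mul (by norm_num), mul_comm]
    refine Set.Finite.of_finite_image (f := DyadicCube.gen) ?_ ?_
    · refine (Set.finite_Icc (-(N : ℤ)) p.gen).subset ?_
      rintro _ ⟨q, ⟨hpq, hq⟩, rfl⟩
      refine ⟨?_, hpq.1⟩
      by_contra! hlt
      have h1 : ((2 : ℝ) ^ (-q.gen)) ^ β ≤ M.toReal := by
        rw [weight, ENNReal.ofReal_le_iff_le_toReal hM.ne] at hq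
        exact hq
      have h3 : (2 : ℝ) ^ N ≤ (2 : ℝ) ^ (-q.gen) := by
        rw [← zpow_natCast]
        exact zpow_le_zpow_right₀ (by norm_num) (by omega)
      exact absurd (hN.trans_le ((Real.rpow_le_rpow (by positivity) h3 hβ.le).trans h1)) (lt_irrefl _)
    -- A cube above `p` contains the base point of `p`, so its generation determines its corner.
    · rintro q ⟨hpq, _⟩ q' ⟨hpq', _⟩ hg
      exact ext' hg (funext fun j => by
        rw [← hpq.2 p.base_mem j, ← hpq'.2 p.base_mem j, hg])

/-- Dyadic cubes of dimension `d` as pairs. -/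
def equivProd (d : ℕ) : DyadicCube d ≃ ℤ × (Fin d → ℤ) where
  toFun q := (q.gen, q.corner)
  invFun p := ⟨p.1, p.2⟩
  left_inv _ := rfl
  right_inv _ := rfl

instance : Countable (DyadicCube d) := (equivProd d).countable_iff.2 inferInstance

instance : Infinite (DyadicCube d) := (equivProd d).infinite_iff.2 inferInstance

theorem toSet_subset_ball (q : DyadicCube d) :
    q.toSet ⊆ Metric.ball q.base (((d : ℝ) + 1) * (2 : ℝ) ^ (-q.gen)) := by
  intro x hx
  have hpos : (0 : ℝ) < (2 : ℝ) ^ (-q.gen) := by positivity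
  have hcoord : ∀ j, |x j - q.base j| ≤ (2 : ℝ) ^ (-q.gen) := by
    intro j
    have h1 := Int.floor_eq_iff.1 (hx j)
    have h2 : x j = (2 : ℝ) ^ (-q.gen) * ((2 : ℝ) ^ q.gen * x j) := by
      rw [← mul_assoc, ← zpow_add₀ two_ne_zero]; simp
    have h3 : x j - q.base j =
        (2 : ℝ) ^ (-q.gen) * ((2 : ℝ) ^ q.gen * x j - q.corner j) := by
      rw [mul_sub, ← h2]; rfl
    rw [h3, abs_mul, abs_of_pos hpos]
    refine mul_le_of_le_one_right hpos.le (abs_le.2 ⟨?_, ?_⟩) <;> linarith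
  rw [Metric.mem_ball, dist_eq_norm]
  -- The factor `√d` is bounded by `d`; the extra `1` in the radius makes the ball open and nonempty
  -- even for `d = 0`.
  have hle : ‖x - q.base‖ ≤ d * (2 : ℝ) ^ (-q.gen) := by
    refine (EuclideanSpace.norm_eq _).le.trans (Real.sqrt_le_iff.2 ⟨by positivity, ?_⟩)
    calc ∑ j, ‖(x - q.base) j‖ ^ 2 ≤ ∑ _j : Fin d, ((2 : ℝ) ^ (-q.gen)) ^ 2 := by
          refine Finset.sum_le_sum fun j _ => ?_
          exact pow_le_pow_left₀ (norm_nonneg _) (hcoord j) 2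
      _ = d * ((2 : ℝ) ^ (-q.gen)) ^ 2 := by simp
      _ ≤ (d : ℝ) ^ 2 * ((2 : ℝ) ^ (-q.gen)) ^ 2 := by
          refine mul_le_mul_of_nonneg_right ?_ (by positivity)
          exact_mod_cast Nat.le_self_pow two_ne_zero d
      _ = _ := by ring
  nlinarith

end DyadicCube

/-- The dyadic content of dimension `β`. -/
noncomputable def dyadicContent (β : ℝ) (E : Set (Space d)) : ℝ≥0∞ :=
  forestContent DyadicCube.toSet (DyadicCube.weight β) E

theorem isCapacity_dyadicContent {β : ℝ} (hβ : 0 < β) :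
    IsCapacity (dyadicContent β : Set (Space d) → ℝ≥0∞) :=
  (DyadicCube.isWeightedForest hβ).isCapacity

theorem omega_pos {β : ℝ} (hβ : 0 < β) : 0 < omega β :=
  div_pos (Real.rpow_pos_of_pos Real.pi_pos _) (Real.Gamma_pos_of_pos (by linarith))

theorem hausdorffContent_le_dyadicContent {β : ℝ} (hβ : 0 < β) (E : Set (Space d)) :
    hausdorffContent β E ≤
      ENNReal.ofReal (omega β * ((d : ℝ) + 1) ^ β) * dyadicContent β E := by
  classical
  have hω := omega_pos hβ
  have hc : 0 < omega β * ((d : ℝ) + 1) ^ β := by positivity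
  unfold dyadicContent forestContent
  rw [ENNReal.mul_iInf_of_ne (by simpa using hc) ENNReal.ofReal_ne_top]
  refine le_iInf fun A => ?_
  rw [ENNReal.mul_iInf_of_ne (by simpa using hc) ENNReal.ofReal_ne_top]
  refine le_iInf fun hA => ?_
  obtain ⟨_⟩ := nonempty_denumerable (DyadicCube d)
  let e : ℕ ≃ DyadicCube d := (Denumerable.eqv (DyadicCube d)).symm
  -- All cubes are enumerated; those outside the cover get radius `0`, hence an empty ball, at no
  -- cost since `β > 0`.
  let r : DyadicCube d → ℝ≥0 := fun q =>
    if q ∈ A then (((d : ℝ) + 1) * (2 : ℝ) ^ (-q.gen)).toNNReal else 0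
  have hr : ∀ q ∈ A, (r q : ℝ) = ((d : ℝ) + 1) * (2 : ℝ) ^ (-q.gen) := fun q hq => by
    simp only [r, if_pos hq]
    exact Real.coe_toNNReal _ (by positivity)
  have hcov : E ⊆ ⋃ i, Metric.ball (e i).base (r (e i)) := by
    intro x hx
    obtain ⟨q, hq, hxq⟩ := Set.mem_iUnion₂.1 (hA hx)
    refine Set.mem_iUnion.2 ⟨e.symm q, ?_⟩
    rw [Equiv.apply_symm_apply, hr q hq]
    exact q.toSet_subset_ball hxq
  refine (iInf₂_le_of_le (fun i => (e i).base) (fun i => r (e i)) (iInf_le _ hcov)).trans ?_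
  rw [e.tsum_eq fun q => ENNReal.ofReal (omega β * (r q : ℝ) ^ β), familyCost,
    ← ENNReal.tsum_mul_left]
  refine ENNReal.tsum_le_tsum fun q => ?_
  by_cases hq : q ∈ A
  · rw [Set.indicator_of_mem hq, DyadicCube.weight, ← ENNReal.ofReal_mul hc.le, hr q hq]
    refine ENNReal.ofReal_le_ofReal (le_of_eq ?_)
    rw [Real.mul_rpow (by positivity) (by positivity), mul_assoc]
  · simp [r, hq, Real.zero_rpow hβ.ne']

/-- Cubes of side between `r` and `2 * r` suffice, at most three in each coordinate direction. -/
theorem dyadicContent_ball_le {β : ℝ} (hβ : 0 < β) (x : Space d) {r : ℝ} (hr : 0 < r) :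
    dyadicContent β (Metric.ball x r) ≤ ENNReal.ofReal (3 ^ d * 2 ^ β * r ^ β) := by
  classical
  obtain ⟨k, hk1, hk2⟩ := exists_mem_Ico_zpow hr (one_lt_two : (1 : ℝ) < 2)
  set g : ℤ := -(k + 1) with hg
  let s : Finset (Fin d → ℤ) := Fintype.piFinset fun j =>
    Finset.Icc (⌊(2 : ℝ) ^ g * x j⌋ - 1) (⌊(2 : ℝ) ^ g * x j⌋ + 1)
  let φ : (Fin d → ℤ) → DyadicCube d := fun m => ⟨g, m⟩
  have hφ : Function.Injective φ := fun m m' h => congrArg DyadicCube.corner h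
  have hgr : (2 : ℝ) ^ g * r ≤ 1 := by
    have : (2 : ℝ) ^ g * (2 : ℝ) ^ (k + 1) = 1 := by
      rw [← zpow_add₀ two_ne_zero]; simp [hg]
    rw [← this]
    exact mul_le_mul_of_nonneg_left hk2.le (by positivity)
  have hcov : Metric.ball x r ⊆ ⋃ q ∈ φ '' (s : Set (Fin d → ℤ)), DyadicCube.toSet q := by
    intro y hy
    refine Set.mem_iUnion₂.2 ⟨φ fun j => ⌊(2 : ℝ) ^ g * y j⌋, ⟨_, ?_, rfl⟩, fun j => rfl⟩
    rw [Finset.mem_coe, Fintype.mem_piFinset]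
    intro j
    have h1 : |y j - x j| ≤ r := by
      have := PiLp.norm_apply_le (y - x) j
      rw [Metric.mem_ball, dist_eq_norm] at hy
      exact this.trans hy.le
    have h2 : |(2 : ℝ) ^ g * y j - (2 : ℝ) ^ g * x j| ≤ 1 := by
      rw [← mul_sub, abs_mul, abs_of_pos (by positivity : (0 : ℝ) < 2 ^ g)]
      exact (mul_le_mul_of_nonneg_left h1 (by positivity)).trans hgr
    rw [abs_le] at h2
    rw [Finset.mem_Icc]
    constructor
    · rw [← Int.floor_sub_one]
      exact Int.floor_le_floor (by linarith)
    · rw [← Int.floor_add_one]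
      exact Int.floor_le_floor (by linarith)
  refine (forestContent_le_cost hcov).trans ?_
  have hcard : s.card = 3 ^ d := by
    simp only [s, Fintype.card_piFinset, Int.card_Icc]
    simp only [show ∀ a : ℤ, (a + 1 + 1 - (a - 1)).toNat = 3 from fun a => by omega]
    simp
  have hcost : familyCost (DyadicCube.weight β) (φ '' (s : Set (Fin d → ℤ))) =
      ∑ m ∈ s, DyadicCube.weight β (φ m) := by
    rw [familyCost, ← Finset.coe_image, ← tsum_subtype, Finset.tsum_subtype',
      Finset.sum_image hφ.injOn]
  rw [hcost]
  have hw : ∀ m ∈ s, DyadicCube.weight β (φ m) = ENNReal.ofReal (((2 : ℝ) ^ (-g)) ^ β) :=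
    fun m _ => rfl
  rw [Finset.sum_congr rfl hw, Finset.sum_const, hcard, nsmul_eq_mul]
  rw [show ((3 ^ d : ℕ) : ℝ≥0∞) = ENNReal.ofReal (3 ^ d) by
    rw [ENNReal.ofReal_pow (by norm_num)]; simp, ← ENNReal.ofReal_mul (by positivity)]
  refine ENNReal.ofReal_le_ofReal ?_
  rw [mul_assoc, ← Real.mul_rpow (by norm_num) hr.le]
  refine mul_le_mul_of_nonneg_left (Real.rpow_le_rpow (by positivity) ?_ hβ.le) (by positivity)
  rw [hg, neg_neg, zpow_add₀ two_ne_zero, zpow_one, mul_comm]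
  linarith

theorem choquetIntegral_le_choquet {β : ℝ} (hβ : 0 < β) (f : Space d → ℝ≥0∞) :
    choquetIntegral β f ≤
      ENNReal.ofReal (omega β * ((d : ℝ) + 1) ^ β) * choquet (dyadicContent β) f := by
  unfold choquetIntegral choquet
  rw [← lintegral_const_mul' _ _ ENNReal.ofReal_ne_top]
  exact lintegral_mono fun t => hausdorffContent_le_dyadicContent hβ _

end Dyadic

/-! ### The heat kernel and its first moment -/

section HeatKernel

variable {d : ℕ}

/-- The heat kernel of `ℝ^d` at time `s`. -/
noncomputable def heatKernel (s : ℝ) (z : Space d) : ℝ :=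
  (4 * Real.pi * s) ^ (-(d : ℝ) / 2) * Real.exp (-‖z‖ ^ 2 / (4 * s))

theorem heatKernel_nonneg {s : ℝ} (hs : 0 ≤ s) (z : Space d) : 0 ≤ heatKernel s z := by
  have := Real.pi_pos
  exact mul_nonneg (Real.rpow_nonneg (by positivity) _) (Real.exp_nonneg _)

theorem continuous_heatKernel (s : ℝ) : Continuous (heatKernel s : Space d → ℝ) := by
  unfold heatKernel; fun_prop

theorem heatKernel_sub_comm (s : ℝ) (x y : Space d) :
    heatKernel s (x - y) = heatKernel s (y - x) := by
  rw [heatKernel, heatKernel, norm_sub_rev]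

theorem heatKernel_le {s : ℝ} (hs : 0 < s) (z : Space d) :
    heatKernel s z ≤ (4 * Real.pi * s) ^ (-(d : ℝ) / 2) := by
  have := Real.pi_pos
  refine mul_le_of_le_one_right (Real.rpow_nonneg (by positivity) _) (Real.exp_le_one_iff.2 ?_)
  exact div_nonpos_of_nonpos_of_nonneg (by simp) (by positivity)

theorem integral_heatKernel {s : ℝ} (hs : 0 < s) : ∫ z : Space d, heatKernel s z = 1 := by
  have hπ := Real.pi_pos
  have h := GaussianFourier.integral_rexp_neg_mul_sq_norm (V := Space d) (b := 1 / (4 * s))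
    (by positivity)
  unfold heatKernel
  rw [integral_const_mul]
  have hrw : ∀ z : Space d, Real.exp (-‖z‖ ^ 2 / (4 * s)) = Real.exp (-(1 / (4 * s)) * ‖z‖ ^ 2) :=
    fun z => by congr 1; ring
  simp_rw [hrw]
  rw [h, finrank_euclideanSpace, Fintype.card_fin,
    show Real.pi / (1 / (4 * s)) = 4 * Real.pi * s by field_simp, neg_div,
    ← Real.rpow_add (by positivity)]
  simp

theorem integrable_heatKernel {s : ℝ} (hs : 0 < s) :
    Integrable (heatKernel s : Space d → ℝ) := by
  refine Integrable.of_integral_ne_zero ?_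
  rw [integral_heatKernel hs]
  exact one_ne_zero

theorem lintegral_heatKernel {s : ℝ} (hs : 0 < s) :
    ∫⁻ z : Space d, ENNReal.ofReal (heatKernel s z) = 1 := by
  rw [← ofReal_integral_eq_lintegral_ofReal (integrable_heatKernel hs)
    (Eventually.of_forall (heatKernel_nonneg hs.le)), integral_heatKernel hs, ENNReal.ofReal_one]

/-- The Gaussian probability measure with the heat kernel at time `r ^ 2` as its density. -/
noncomputable def heatMeasure (d : ℕ) (r : ℝ) : Measure (Space d) :=
  volume.withDensity fun z => ENNReal.ofReal (heatKernel (r ^ 2) z)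

theorem isProbabilityMeasure_heatMeasure {r : ℝ} (hr : 0 < r) :
    IsProbabilityMeasure (heatMeasure d r) :=
  ⟨by rw [heatMeasure, withDensity_apply _ MeasurableSet.univ, Measure.restrict_univ,
    lintegral_heatKernel (by positivity)]⟩

theorem measurable_ofReal_heatKernel (s : ℝ) :
    Measurable fun z : Space d => ENNReal.ofReal (heatKernel s z) :=
  (continuous_heatKernel s).measurable.ennreal_ofReal

theorem integral_heatMeasure (r : ℝ) (g : Space d → ℝ) :
    ∫ z, g z ∂(heatMeasure d r) = ∫ z, heatKernel (r ^ 2) z * g z := by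
  rw [heatMeasure, integral_withDensity_eq_integral_toReal_smul (measurable_ofReal_heatKernel _)
    (by simp)]
  refine integral_congr_ae (Eventually.of_forall fun z => ?_)
  simp only [smul_eq_mul]
  rw [ENNReal.toReal_ofReal (heatKernel_nonneg (sq_nonneg r) z)]

/-- A bound for the first moment of the heat kernel. -/
noncomputable def momentConst (d : ℕ) : ℝ := 2 * (2 : ℝ) ^ ((d : ℝ) / 2)

theorem one_le_momentConst (d : ℕ) : 1 ≤ momentConst d := by
  have : (1 : ℝ) ≤ (2 : ℝ) ^ ((d : ℝ) / 2) := Real.one_le_rpow (by norm_num) (by positivity)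
  unfold momentConst
  linarith

/-- Half of the Gaussian exponent absorbs the factor `‖z‖`; what remains is the kernel at twice the
time, of mass one, and `2 ^ (d / 2)` is the ratio of the normalisations. -/
theorem norm_mul_heatKernel_le {r : ℝ} (hr : 0 < r) (z : Space d) :
    ‖z‖ * heatKernel (r ^ 2) z ≤ momentConst d * r * heatKernel (2 * r ^ 2) z := by
  have hπ := Real.pi_pos
  have hexp : ‖z‖ * Real.exp (-‖z‖ ^ 2 / (4 * r ^ 2)) ≤
      2 * r * Real.exp (-‖z‖ ^ 2 / (4 * (2 * r ^ 2))) := by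
    set u := ‖z‖ / r with hu
    have hz : ‖z‖ = u * r := by rw [hu]; field_simp
    have e1 : -‖z‖ ^ 2 / (4 * r ^ 2) = -(u ^ 2 / 8) + -(u ^ 2 / 8) := by
      rw [hz]; field_simp; ring
    have e2 : -‖z‖ ^ 2 / (4 * (2 * r ^ 2)) = -(u ^ 2 / 8) := by
      rw [hz]; field_simp; ring
    rw [e1, e2, Real.exp_add, ← mul_assoc]
    refine mul_le_mul_of_nonneg_right ?_ (Real.exp_nonneg _)
    have h1 := Real.add_one_le_exp (u ^ 2 / 8)
    rw [Real.exp_neg, ← div_eq_mul_inv, div_le_iff₀ (Real.exp_pos _), hz]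
    nlinarith [sq_nonneg (u - 2), mul_le_mul_of_nonneg_left h1 hr.le]
  have hconst : (4 * Real.pi * r ^ 2) ^ (-(d : ℝ) / 2) =
      (2 : ℝ) ^ ((d : ℝ) / 2) * (4 * Real.pi * (2 * r ^ 2)) ^ (-(d : ℝ) / 2) := by
    have ha : 0 ≤ 4 * Real.pi * r ^ 2 := by positivity
    rw [show 4 * Real.pi * (2 * r ^ 2) = 2 * (4 * Real.pi * r ^ 2) by ring,
      Real.mul_rpow two_pos.le ha, ← mul_assoc, ← Real.rpow_add two_pos,
      neg_div, add_neg_cancel, Real.rpow_zero, one_mul]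
  unfold heatKernel
  rw [hconst]
  set p := (4 * Real.pi * (2 * r ^ 2)) ^ (-(d : ℝ) / 2)
  set q := (2 : ℝ) ^ ((d : ℝ) / 2) with hq
  have hp : 0 ≤ p := Real.rpow_nonneg (by positivity) _
  have hq0 : 0 ≤ q := Real.rpow_nonneg (by norm_num) _
  calc _ = q * p * (‖z‖ * Real.exp (-‖z‖ ^ 2 / (4 * r ^ 2))) := by ring
    _ ≤ q * p * (2 * r * Real.exp (-‖z‖ ^ 2 / (4 * (2 * r ^ 2)))) :=
        mul_le_mul_of_nonneg_left hexp (by positivity)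
    _ = _ := by rw [momentConst, ← hq]; ring

theorem lintegral_enorm_heatMeasure_le {r : ℝ} (hr : 0 < r) :
    ∫⁻ z, ‖z‖ₑ ∂(heatMeasure d r) ≤ ENNReal.ofReal (momentConst d * r) := by
  have hc := one_le_momentConst d
  rw [heatMeasure, lintegral_withDensity_eq_lintegral_mul _ (measurable_ofReal_heatKernel _)
    measurable_enorm]
  calc ∫⁻ z : Space d, ENNReal.ofReal (heatKernel (r ^ 2) z) * ‖z‖ₑ
      ≤ ∫⁻ z : Space d, ENNReal.ofReal (momentConst d * r) *
          ENNReal.ofReal (heatKernel (2 * r ^ 2) z) := by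
        refine lintegral_mono fun z => ?_
        rw [← ofReal_norm, ← ENNReal.ofReal_mul (heatKernel_nonneg (sq_nonneg r) z),
          ← ENNReal.ofReal_mul (by positivity)]
        refine ENNReal.ofReal_le_ofReal ?_
        rw [mul_comm]
        exact norm_mul_heatKernel_le hr z
    _ = _ := by
        rw [lintegral_const_mul _ (measurable_ofReal_heatKernel _),
          lintegral_heatKernel (by positivity), mul_one]

end HeatKernel

/-! ### `L¹` smoothness measured by iterated differences -/

section Differences

variable {d : ℕ}

/-- The iterated differences of order `m` of `f` have `L¹` norm at most `K` times the product of
the norms of the increments. -/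
def DiffBound : ℕ → (Space d → ℝ) → ℝ≥0∞ → Prop
  | 0, f, K => ∫⁻ x, ‖f x‖ₑ ≤ K
  | m + 1, f, K => ∀ y, DiffBound m (fun x => f x - f (x - y)) (‖y‖ₑ * K)

namespace DiffBound

theorem mono {m : ℕ} {f : Space d → ℝ} {K K' : ℝ≥0∞} (h : DiffBound m f K) (hK : K ≤ K') :
    DiffBound m f K' := by
  induction m generalizing f K K' with
  | zero => exact le_trans h hK
  | succ m ih => exact fun y => ih (h y) (mul_le_mul_right hK _)

theorem comp_sub {m : ℕ} {f : Space d → ℝ} {K : ℝ≥0∞} (h : DiffBound m f K) (z : Space d) :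
    DiffBound m (fun x => f (x - z)) K := by
  induction m generalizing f K with
  | zero =>
    refine le_trans (le_of_eq ?_) h
    exact lintegral_sub_right_eq_self (fun x => ‖f x‖ₑ) z
  | succ m ih =>
    intro y
    have := ih (h y)
    simpa only [sub_right_comm] using this

theorem sub {m : ℕ} {f g : Space d → ℝ} {K K' : ℝ≥0∞} (hf : DiffBound m f K)
    (hg : DiffBound m g K') (hfc : Continuous f) :
    DiffBound m (fun x => f x - g x) (K + K') := by
  induction m generalizing f g K K' with
  | zero =>
    calc ∫⁻ x, ‖f x - g x‖ₑ ≤ ∫⁻ x, (‖f x‖ₑ + ‖g x‖ₑ) := lintegral_mono fun x => enorm_sub_le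
      _ = _ := lintegral_add_left hfc.measurable.enorm _
      _ ≤ _ := add_le_add hf hg
  | succ m ih =>
    intro y
    have := ih (hf y) (hg y) (by fun_prop)
    rw [mul_add]
    convert this using 2 with x
    ring

/-- Minkowski's integral inequality. The uniform bound `M` only provides integrability, so that
differences pass under the integral. -/
theorem integral {m : ℕ} {γ : Measure (Space d)} [IsFiniteMeasure γ] {F : Space d → Space d → ℝ}
    (hF : Continuous (Function.uncurry F)) {M : ℝ} (hM : ∀ z x, |F z x| ≤ M)
    {k : Space d → ℝ≥0∞} (h : ∀ z, DiffBound m (F z) (k z)) :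
    DiffBound m (fun x => ∫ z, F z x ∂γ) (∫⁻ z, k z ∂γ) := by
  induction m generalizing F M k with
  | zero =>
    calc ∫⁻ x, ‖∫ z, F z x ∂γ‖ₑ ≤ ∫⁻ x, ∫⁻ z, ‖F z x‖ₑ ∂γ :=
          lintegral_mono fun x => enorm_integral_le_lintegral_enorm _
      _ = ∫⁻ z, (∫⁻ x, ‖F z x‖ₑ) ∂γ := by
          refine lintegral_lintegral_swap (μ := volume) (ν := γ) (f := fun x z => ‖F z x‖ₑ) ?_
          exact (hF.comp continuous_swap).measurable.enorm.aemeasurable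
      _ ≤ ∫⁻ z, k z ∂γ := lintegral_mono fun z => h z
  | succ m ih =>
    intro y
    have hint : ∀ x, Integrable (fun z => F z x) γ := fun x =>
      Integrable.of_bound (hF.comp (by fun_prop : Continuous fun z => (z, x))).aestronglyMeasurable
        M (Eventually.of_forall fun z => hM z x)
    have := ih (F := fun z x => F z x - F z (x - y)) (M := M + M) (k := fun z => ‖y‖ₑ * k z)
      (hF.sub (hF.comp (by fun_prop : Continuous fun p : Space d × Space d => (p.1, p.2 - y))))
      (fun z x => (abs_sub _ _).trans (add_le_add (hM z x) (hM z _))) (fun z => h z y)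
    rw [lintegral_const_mul' _ _ enorm_ne_top] at this
    convert this using 2 with x
    exact (integral_sub (hint x) (hint (x - y))).symm

end DiffBound

end Differences

variable {d : ℕ}

/-! ### Subtracting a Gaussian average: one step -/

section HeatRemainder

/-- A continuous bounded function. -/
def IsBddContinuous (f : Space d → ℝ) : Prop := Continuous f ∧ ∃ M, ∀ x, |f x| ≤ M

/-- The average of `f` against the Gaussian measure. -/
noncomputable def heatAvg (r : ℝ) (f : Space d → ℝ) (x : Space d) : ℝ :=
  ∫ z, f (x - z) ∂(heatMeasure d r)

/-- The difference of `f` and its Gaussian average. -/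
noncomputable def heatRem (r : ℝ) (f : Space d → ℝ) (x : Space d) : ℝ :=
  ∫ z, (f x - f (x - z)) ∂(heatMeasure d r)

namespace IsBddContinuous

variable {f : Space d → ℝ}

theorem integrable (hf : IsBddContinuous f) (γ : Measure (Space d)) [IsFiniteMeasure γ] :
    Integrable f γ := by
  obtain ⟨hc, M, hM⟩ := hf
  exact Integrable.of_bound hc.aestronglyMeasurable M (Eventually.of_forall hM)

theorem comp_sub_left (hf : IsBddContinuous f) (x : Space d) :
    IsBddContinuous fun z => f (x - z) :=
  ⟨hf.1.comp (by fun_prop), hf.2.imp fun _ hM z => hM _⟩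

theorem heatAvg (hf : IsBddContinuous f) {r : ℝ} (hr : 0 < r) :
    IsBddContinuous (heatAvg r f) := by
  have := isProbabilityMeasure_heatMeasure (d := d) hr
  obtain ⟨hc, M, hM⟩ := hf
  refine ⟨?_, M, fun x => ?_⟩
  · refine continuous_of_dominated (bound := fun _ => M) (fun x => ?_) (fun x => ?_)
      (integrable_const _) (Eventually.of_forall fun z => hc.comp (by fun_prop))
    · exact (hc.comp (by fun_prop : Continuous fun z => x - z)).aestronglyMeasurable
    · exact Eventually.of_forall fun z => hM _
  · refine (norm_integral_le_of_norm_le_const (μ := heatMeasure d r) (f := fun z => f (x - z))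
      (Eventually.of_forall fun z => hM _)).trans ?_
    simp

theorem heatRem_eq (hf : IsBddContinuous f) {r : ℝ} (hr : 0 < r) (x : Space d) :
    heatRem r f x = f x - DimStable.heatAvg r f x := by
  have := isProbabilityMeasure_heatMeasure (d := d) hr
  rw [heatRem, DimStable.heatAvg, integral_sub (integrable_const _)
    ((hf.comp_sub_left x).integrable _)]
  simp

theorem heatRem (hf : IsBddContinuous f) {r : ℝ} (hr : 0 < r) :
    IsBddContinuous (heatRem r f) := by
  obtain ⟨hc, M, hM⟩ := id hf
  obtain ⟨hc', M', hM'⟩ := hf.heatAvg hr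
  rw [show DimStable.heatRem r f = fun x => f x - DimStable.heatAvg r f x from
    funext (hf.heatRem_eq hr)]
  exact ⟨hc.sub hc', M + M', fun x => (abs_sub _ _).trans (add_le_add (hM x) (hM' x))⟩

end IsBddContinuous

/-- One order of smoothness is traded for a factor `r`: the remainder averages the differences by
`z`, whose bounds carry `‖z‖`, and the first moment of the Gaussian is at most `momentConst d * r`.
-/
theorem DiffBound.heatRem_succ {m : ℕ} {f : Space d → ℝ} {K : ℝ≥0∞} (h : DiffBound (m + 1) f K)
    (hf : IsBddContinuous f) {r : ℝ} (hr : 0 < r) :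
    DiffBound m (heatRem r f) (ENNReal.ofReal (momentConst d * r) * K) := by
  have := isProbabilityMeasure_heatMeasure (d := d) hr
  obtain ⟨hc, M, hM⟩ := hf
  have h1 := DiffBound.integral (γ := heatMeasure d r) (F := fun z x => f x - f (x - z))
    (M := M + M) (k := fun z => ‖z‖ₑ * K) (by simp only [Function.uncurry_def]; fun_prop)
    (fun z x => (abs_sub _ _).trans (add_le_add (hM _) (hM _))) (fun z => h z)
  rw [lintegral_mul_const _ measurable_enorm] at h1
  exact h1.mono (mul_le_mul_left (lintegral_enorm_heatMeasure_le hr) K)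

theorem DiffBound.heatRem {m : ℕ} {f : Space d → ℝ} {K : ℝ≥0∞} (h : DiffBound m f K)
    (hf : IsBddContinuous f) {r : ℝ} (hr : 0 < r) :
    DiffBound m (heatRem r f) (2 * K) := by
  have := isProbabilityMeasure_heatMeasure (d := d) hr
  obtain ⟨hc, M, hM⟩ := hf
  have h1 := DiffBound.integral (γ := heatMeasure d r) (F := fun z x => f x - f (x - z))
    (M := M + M) (k := fun z => K + K) (by simp only [Function.uncurry_def]; fun_prop)
    (fun z x => (abs_sub _ _).trans (add_le_add (hM _) (hM _)))
    (fun z => h.sub (h.comp_sub z) hc)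
  refine h1.mono (le_of_eq ?_)
  simp [two_mul]

theorem abs_heatRem_le {f : Space d → ℝ} {r : ℝ} (hr : 0 < r) {K : ℝ}
    (hK : 0 ≤ K) (hlip : ∀ x y, |f x - f (x - y)| ≤ K * ‖y‖) (x : Space d) :
    |heatRem r f x| ≤ K * (momentConst d * r) := by
  have hc := one_le_momentConst d
  have h1 : ‖heatRem r f x‖ₑ ≤ ENNReal.ofReal (K * (momentConst d * r)) := by
    calc ‖heatRem r f x‖ₑ ≤ ∫⁻ z, ‖f x - f (x - z)‖ₑ ∂(heatMeasure d r) :=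
          enorm_integral_le_lintegral_enorm _
      _ ≤ ∫⁻ z, ENNReal.ofReal K * ‖z‖ₑ ∂(heatMeasure d r) := by
          refine lintegral_mono fun z => ?_
          rw [← ofReal_norm, ← ofReal_norm, ← ENNReal.ofReal_mul hK]
          exact ENNReal.ofReal_le_ofReal (hlip x z)
      _ ≤ _ := by
          rw [lintegral_const_mul _ measurable_enorm, ENNReal.ofReal_mul hK]
          exact mul_le_mul_right (lintegral_enorm_heatMeasure_le hr) _
  rw [← ofReal_norm, ENNReal.ofReal_le_ofReal_iff (by positivity)] at h1
  exact h1

theorem abs_heatRem_sub_le {f : Space d → ℝ} (hf : IsBddContinuous f) {r : ℝ} (hr : 0 < r) {K : ℝ}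
    (hlip : ∀ x y, |f x - f (x - y)| ≤ K * ‖y‖) (x y : Space d) :
    |heatRem r f x - heatRem r f (x - y)| ≤ 2 * K * ‖y‖ := by
  have := isProbabilityMeasure_heatMeasure (d := d) hr
  have hi : ∀ x, Integrable (fun z => f x - f (x - z)) (heatMeasure d r) := fun x =>
    (integrable_const _).sub ((hf.comp_sub_left x).integrable _)
  rw [heatRem, heatRem, ← integral_sub (hi x) (hi (x - y))]
  refine (norm_integral_le_of_norm_le_const (μ := heatMeasure d r) (C := 2 * K * ‖y‖)
    (f := fun z => f x - f (x - z) - (f (x - y) - f (x - y - z)))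
    (Eventually.of_forall fun z => ?_)).trans ?_
  · have h1 := hlip x y
    have h2 := hlip (x - z) y
    rw [sub_right_comm x z y] at h2
    rw [Real.norm_eq_abs]
    calc |f x - f (x - z) - (f (x - y) - f (x - y - z))|
        = |(f x - f (x - y)) - (f (x - z) - f (x - y - z))| := by congr 1; ring
      _ ≤ K * ‖y‖ + K * ‖y‖ := (abs_sub _ _).trans (add_le_add h1 h2)
      _ = _ := by ring
  · simp

end HeatRemainder

/-! ### Integrals against signed measures and duality with the heat extension -/

section SignedIntegral

theorem vectorIntegral_eq_sub (a : FinRadon d) {f : Space d → ℝ} (hf : IsBddContinuous f) :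
    ∫ᵛ x, f x ∂•a = ∫ x, f x ∂a.toJordanDecomposition.posPart -
      ∫ x, f x ∂a.toJordanDecomposition.negPart := by
  have hB : ContinuousLinearMap.lsmul ℝ ℝ (E := ℝ) = (ContinuousLinearMap.lsmul ℝ ℝ (E := ℝ)).flip := by
    ext; simp
  rw [← VectorMeasure.integral_toSignedMeasure, ← VectorMeasure.integral_toSignedMeasure,
    ← VectorMeasure.integral_sub_vectorMeasure]
  · conv_lhs => rw [hB, ← a.toSignedMeasure_toJordanDecomposition]
    rfl
  · simpa [VectorMeasure.Integrable] using hf.integrable _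
  · simpa [VectorMeasure.Integrable] using hf.integrable _

theorem vectorIntegrable (a : FinRadon d) {f : Space d → ℝ} (hf : IsBddContinuous f) :
    VectorMeasure.Integrable a f := by
  rw [VectorMeasure.Integrable, ← SignedMeasure.totalVariation_eq_variation]
  exact hf.integrable _

theorem isBddContinuous_heatKernel {s : ℝ} (hs : 0 < s) (x : Space d) :
    IsBddContinuous fun y => heatKernel s (x - y) :=
  ⟨(continuous_heatKernel s).comp (by fun_prop), _, fun y => by
    rw [abs_of_nonneg (heatKernel_nonneg hs.le _)]
    exact heatKernel_le hs _⟩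

theorem heatExt_eq (a : FinRadon d) (s : ℝ) (x : Space d) :
    heatExt a s x = ∫ᵛ y, heatKernel s (x - y) ∂•a := rfl

theorem heatAvg_eq (r : ℝ) (f : Space d → ℝ) (x : Space d) :
    heatAvg r f x = ∫ z, f z * heatKernel (r ^ 2) (z - x) := by
  rw [heatAvg, integral_heatMeasure,
    ← integral_sub_left_eq_self (fun z => f z * heatKernel (r ^ 2) (z - x)) volume x]
  refine integral_congr_ae (Eventually.of_forall fun z => ?_)
  simp only
  rw [heatKernel_sub_comm (r ^ 2) (x - z) x, sub_sub_cancel, mul_comm]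

theorem integrable_prod_heatKernel (γ : Measure (Space d)) [IsFiniteMeasure γ] {f : Space d → ℝ}
    (hf : Integrable f) {r : ℝ} (hr : 0 < r) :
    Integrable (fun p : Space d × Space d => f p.2 * heatKernel (r ^ 2) (p.2 - p.1))
      (γ.prod volume) := by
  refine Integrable.mul_bdd (c := (4 * Real.pi * r ^ 2) ^ (-(d : ℝ) / 2)) (hf.comp_snd γ) ?_ ?_
  · exact ((continuous_heatKernel _).comp (by fun_prop)).aestronglyMeasurable
  · refine Eventually.of_forall fun p => ?_
    rw [Real.norm_eq_abs, abs_of_nonneg (heatKernel_nonneg (sq_nonneg r) _)]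
    exact heatKernel_le (by positivity) _

/-- By Fubini and the symmetry of the kernel, the average moves from the test function to the
measure. -/
theorem vectorIntegral_heatAvg (a : FinRadon d) {f : Space d → ℝ} (hf : IsBddContinuous f)
    (hfi : Integrable f) {r : ℝ} (hr : 0 < r) :
    ∫ᵛ y, heatAvg r f y ∂•a = ∫ z, f z * heatExt a (r ^ 2) z := by
  have hr2 : 0 < r ^ 2 := by positivity
  have hswap : ∀ γ : Measure (Space d), IsFiniteMeasure γ →
      ∫ y, heatAvg r f y ∂γ = ∫ z, f z * ∫ y, heatKernel (r ^ 2) (z - y) ∂γ := by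
    intro γ _
    simp_rw [heatAvg_eq]
    rw [integral_integral_swap (integrable_prod_heatKernel γ hfi hr)]
    simp_rw [integral_const_mul]
  have hint : ∀ γ : Measure (Space d), IsFiniteMeasure γ →
      Integrable fun z => f z * ∫ y, heatKernel (r ^ 2) (z - y) ∂γ := by
    intro γ _
    have := (integrable_prod_heatKernel γ hfi hr).integral_prod_right
    simpa only [integral_const_mul] using this
  rw [vectorIntegral_eq_sub a (hf.heatAvg hr), hswap _ inferInstance, hswap _ inferInstance,
    ← integral_sub (hint _ inferInstance) (hint _ inferInstance)]
  refine integral_congr_ae (Eventually.of_forall fun z => ?_)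
  simp only
  rw [heatExt_eq, vectorIntegral_eq_sub a (isBddContinuous_heatKernel hr2 z), mul_sub]

theorem abs_vectorIntegral_heatAvg_le (a : FinRadon d) {f : Space d → ℝ} (hf : IsBddContinuous f)
    {r b B : ℝ} (hr : 0 < r) (hb0 : 0 ≤ b) (hb : DiffBound 0 f (ENNReal.ofReal b))
    (hB : ∀ z, |heatExt a (r ^ 2) z| ≤ B) :
    |∫ᵛ y, heatAvg r f y ∂•a| ≤ b * B := by
  have hfi : Integrable f :=
    ⟨hf.1.aestronglyMeasurable, lt_of_le_of_lt hb ENNReal.ofReal_lt_top⟩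
  have hB0 : 0 ≤ B := (abs_nonneg _).trans (hB 0)
  rw [vectorIntegral_heatAvg a hf hfi hr]
  calc |∫ z, f z * heatExt a (r ^ 2) z| ≤ ∫ z, ‖f z‖ * B := by
        refine norm_integral_le_of_norm_le (f := fun z => f z * heatExt a (r ^ 2) z) (hfi.norm.mul_const B) (Eventually.of_forall fun z => ?_)
        rw [norm_mul]
        exact mul_le_mul_of_nonneg_left (hB z) (norm_nonneg _)
    _ = (∫ z, ‖f z‖) * B := integral_mul_const _ _
    _ ≤ b * B := by
        refine mul_le_mul_of_nonneg_right ?_ hB0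
        rw [integral_norm_eq_lintegral_enorm hf.1.aestronglyMeasurable]
        exact ENNReal.toReal_le_of_le_ofReal hb0 hb

theorem abs_vectorIntegral_le (a : FinRadon d) {f : Space d → ℝ} {B : ℝ}
    (hB0 : 0 ≤ B) (hB : ∀ᵐ x ∂a.totalVariation, |f x| ≤ B) :
    |∫ᵛ x, f x ∂•a| ≤ B * (a.totalVariation Set.univ).toReal := by
  have h1 := VectorMeasure.enorm_integral_le_lintegral_enorm_transpose (μ := a) (f := f)
    (B := ContinuousLinearMap.lsmul ℝ ℝ (E := ℝ))
  rw [VectorMeasure.variation_transpose_lsmul, ← SignedMeasure.totalVariation_eq_variation] at h1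
  have h2 : ∫⁻ x, ‖f x‖ₑ ∂a.totalVariation ≤ ENNReal.ofReal B * a.totalVariation Set.univ := by
    rw [← lintegral_const]
    refine lintegral_mono_ae (hB.mono fun x hx => ?_)
    rw [← ofReal_norm]
    exact ENNReal.ofReal_le_ofReal hx
  have h3 := h1.trans h2
  rw [← ENNReal.ofReal_toReal (measure_ne_top a.totalVariation Set.univ),
    ← ENNReal.ofReal_mul hB0, ← ofReal_norm, ENNReal.ofReal_le_ofReal_iff (by positivity)] at h3
  exact h3

end SignedIntegral

/-! ### Iterated Gaussian averages: from heat bounds to general test functions -/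

section Iteration

/-- The remainders left after subtracting successively the Gaussian averages at the scales
`r / 4 ^ j`. -/
noncomputable def heatRemSeq (r : ℝ) (f : Space d → ℝ) : ℕ → Space d → ℝ
  | 0 => f
  | j + 1 => heatRem (r / 4 ^ j) (heatRemSeq r f j)

variable {f : Space d → ℝ} {r : ℝ}

theorem isBddContinuous_heatRemSeq (hf : IsBddContinuous f) (hr : 0 < r) (j : ℕ) :
    IsBddContinuous (heatRemSeq r f j) := by
  induction j with
  | zero => exact hf
  | succ j ih => exact ih.heatRem (by positivity)

theorem DiffBound.heatRemSeq {m : ℕ} {K : ℝ≥0∞} (h : DiffBound m f K) (hf : IsBddContinuous f)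
    (hr : 0 < r) (j : ℕ) : DiffBound m (heatRemSeq r f j) (2 ^ j * K) := by
  induction j with
  | zero => simpa [DimStable.heatRemSeq] using h
  | succ j ih =>
    rw [pow_succ', mul_assoc]
    exact ih.heatRem (isBddContinuous_heatRemSeq hf hr j) (by positivity)

theorem DiffBound.heatRemSeq_add {m i j : ℕ} {K : ℝ≥0∞} (hf : IsBddContinuous f) (hr : 0 < r)
    (h : DiffBound (m + i) (DimStable.heatRemSeq r f j) K) :
    DiffBound m (DimStable.heatRemSeq r f (j + i))
      (ENNReal.ofReal (momentConst d * (r / 4 ^ j)) ^ i * K) := by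
  have hc := one_le_momentConst d
  induction i generalizing m with
  | zero => simpa using h
  | succ i ih =>
    have h1 := ih (m := m + 1) (by rwa [add_assoc, add_comm 1 i])
    have h2 := h1.heatRem_succ (isBddContinuous_heatRemSeq hf hr (j + i))
      (r := r / 4 ^ (j + i)) (by positivity)
    refine h2.mono ?_
    rw [pow_succ', mul_assoc]
    refine mul_le_mul_left (ENNReal.ofReal_le_ofReal ?_) _
    refine mul_le_mul_of_nonneg_left ?_ (by positivity)
    exact div_le_div_of_nonneg_left hr.le (by positivity)
      (pow_le_pow_right₀ (by norm_num) (Nat.le_add_right j i))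

/-- The constant in the decay of the `L¹` norms of the remainders. -/
noncomputable def decayConst (d N : ℕ) : ℝ := 4 ^ (N * N) * momentConst d ^ N

theorem decayConst_pos (d N : ℕ) : 0 < decayConst d N := by
  have := one_le_momentConst d
  unfold decayConst
  positivity

/-- For `j ≥ N` the last `N` steps each trade one order of smoothness, at scales at most `r / 4 ^ (j
- N)`, while every earlier step costs a factor `2`. The factor `4 ^ (N * N)` compensates for this
delay and covers the indices `j < N`. -/
theorem diffBound_zero_heatRemSeq {N : ℕ} {κ : ℝ} (hκ : 0 ≤ κ) (hf : IsBddContinuous f)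
    (hr : 0 < r) (h0 : DiffBound 0 f (ENNReal.ofReal κ))
    (hN : DiffBound N f (ENNReal.ofReal (r⁻¹ ^ N * κ))) (j : ℕ) :
    DiffBound 0 (heatRemSeq r f j) (ENNReal.ofReal (decayConst d N * 2 ^ j / 4 ^ (j * N) * κ)) := by
  have hc := one_le_momentConst d
  have htwo : ∀ i : ℕ, (2 : ℝ≥0∞) ^ i = ENNReal.ofReal (2 ^ i) := fun i => by
    rw [ENNReal.ofReal_pow (by norm_num)]; simp
  rcases lt_or_ge j N with hj | hj
  · refine (h0.heatRemSeq hf hr j).mono ?_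
    rw [htwo, ← ENNReal.ofReal_mul (by positivity)]
    refine ENNReal.ofReal_le_ofReal (mul_le_mul_of_nonneg_right ?_ hκ)
    rw [le_div_iff₀ (by positivity), mul_comm]
    refine mul_le_mul_of_nonneg_right ?_ (by positivity)
    calc (4 : ℝ) ^ (j * N) ≤ 4 ^ (N * N) :=
          pow_le_pow_right₀ (by norm_num) (Nat.mul_le_mul_right N hj.le)
      _ ≤ decayConst d N := le_mul_of_one_le_right (by positivity) (one_le_pow₀ hc)
  · obtain ⟨i, rfl⟩ := Nat.exists_eq_add_of_le' hj
    have h1 := hN.heatRemSeq hf hr i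
    rw [← zero_add N] at h1
    have h2 := DiffBound.heatRemSeq_add hf hr h1
    rw [zero_add] at h2
    refine h2.mono ?_
    rw [htwo, ← ENNReal.ofReal_mul (by positivity), ← ENNReal.ofReal_pow (by positivity),
      ← ENNReal.ofReal_mul (by positivity)]
    refine ENNReal.ofReal_le_ofReal ?_
    have e1 : (momentConst d * (r / 4 ^ i)) ^ N * (2 ^ i * (r⁻¹ ^ N * κ)) =
        momentConst d ^ N * 2 ^ i / 4 ^ (i * N) * κ := by
      rw [mul_pow, div_pow, ← pow_mul, inv_pow]
      field_simp
    have e2 : decayConst d N * 2 ^ (i + N) / 4 ^ ((i + N) * N) * κ =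
        momentConst d ^ N * 2 ^ (i + N) / 4 ^ (i * N) * κ := by
      rw [decayConst, add_mul, pow_add 4]
      field_simp
    rw [e1, e2]
    have : (2 : ℝ) ^ i ≤ 2 ^ (i + N) := pow_le_pow_right₀ (by norm_num) (Nat.le_add_right i N)
    gcongr

theorem abs_heatRemSeq_sub_le (hf : IsBddContinuous f) (hr : 0 < r) {K : ℝ}
    (hlip : ∀ x y, |f x - f (x - y)| ≤ K * ‖y‖) (j : ℕ) (x y : Space d) :
    |heatRemSeq r f j x - heatRemSeq r f j (x - y)| ≤ 2 ^ j * K * ‖y‖ := by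
  induction j generalizing x y with
  | zero => simpa [heatRemSeq] using hlip x y
  | succ j ih =>
    have := abs_heatRem_sub_le (isBddContinuous_heatRemSeq hf hr j) (r := r / 4 ^ j)
      (by positivity) ih x y
    rwa [← mul_assoc, ← pow_succ'] at this

/-- The Lipschitz constant at most doubles per step while the scale shrinks fourfold, so the
remainders tend to zero uniformly. -/
theorem abs_heatRemSeq_succ_le (hf : IsBddContinuous f) (hr : 0 < r) {K : ℝ} (hK : 0 ≤ K)
    (hlip : ∀ x y, |f x - f (x - y)| ≤ K * ‖y‖) (j : ℕ) (x : Space d) :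
    |heatRemSeq r f (j + 1) x| ≤ K * momentConst d * r * (1 / 2) ^ j := by
  refine (abs_heatRem_le (r := r / 4 ^ j) (by positivity) (K := 2 ^ j * K) (by positivity)
    (abs_heatRemSeq_sub_le hf hr hlip j) x).trans (le_of_eq ?_)
  rw [show (4 : ℝ) = 2 * 2 by norm_num, mul_pow, one_div, inv_pow]
  field_simp

theorem vectorIntegral_eq_sum_add (a : FinRadon d) (hf : IsBddContinuous f) (hr : 0 < r) (J : ℕ) :
    ∫ᵛ x, f x ∂•a = ∑ j ∈ Finset.range J, ∫ᵛ x, heatAvg (r / 4 ^ j) (heatRemSeq r f j) x ∂•a +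
      ∫ᵛ x, heatRemSeq r f J x ∂•a := by
  induction J with
  | zero => simp [heatRemSeq]
  | succ J ih =>
    have hb := isBddContinuous_heatRemSeq hf hr J
    have hrJ : 0 < r / 4 ^ J := by positivity
    rw [ih, Finset.sum_range_succ, add_assoc, ← VectorMeasure.integral_fun_add
      (vectorIntegrable a (hb.heatAvg hrJ))
      (vectorIntegrable a (isBddContinuous_heatRemSeq hf hr (J + 1)))]
    congr 2
    ext x
    have := hb.heatRem_eq hrJ x
    simp only [heatRemSeq]
    linarith

/-- The final bound involves neither the Lipschitz constant `K` nor the total variation of `a`: both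
enter only through the last remainder, which vanishes in the limit. -/
theorem abs_vectorIntegral_le_of_heatExt_le (a : FinRadon d) {γ A κ K : ℝ} (hγ : γ ≤ d)
    (hA : ∀ s z, 0 < s → |heatExt a (s ^ 2) z| ≤ A * s ^ (-γ)) (hκ : 0 ≤ κ)
    (hf : IsBddContinuous f) (hr : 0 < r) (hK : 0 ≤ K)
    (hlip : ∀ x y, |f x - f (x - y)| ≤ K * ‖y‖) (h0 : DiffBound 0 f (ENNReal.ofReal κ))
    (hN : DiffBound (d + 1) f (ENNReal.ofReal (r⁻¹ ^ (d + 1) * κ))) :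
    |∫ᵛ x, f x ∂•a| ≤ 2 * decayConst d (d + 1) * κ * A * r ^ (-γ) := by
  have hD := decayConst_pos d (d + 1)
  have hc := one_le_momentConst d
  have hA0 : 0 ≤ A := by simpa using (abs_nonneg _).trans (hA 1 0 one_pos)
  set V := (a.totalVariation Set.univ).toReal with hV
  have hV0 : 0 ≤ V := ENNReal.toReal_nonneg
  set D := decayConst d (d + 1)
  have hterm : ∀ j : ℕ, |∫ᵛ x, heatAvg (r / 4 ^ j) (heatRemSeq r f j) x ∂•a| ≤
      D * κ * A * r ^ (-γ) * (1 / 2) ^ j := by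
    intro j
    have h1 := abs_vectorIntegral_heatAvg_le a (isBddContinuous_heatRemSeq hf hr j)
      (r := r / 4 ^ j) (by positivity) (by positivity)
      (diffBound_zero_heatRemSeq hκ hf hr h0 hN j) (fun z => hA (r / 4 ^ j) z (by positivity))
    refine h1.trans ?_
    -- The heat bound at scale `r / 4 ^ j` loses at most `4 ^ (j * d)`; the decay `2 ^ j / 4 ^ (j *
    -- (d + 1))` leaves `(1 / 2) ^ j`.
    have h2 : (r / 4 ^ j) ^ (-γ) ≤ r ^ (-γ) * 4 ^ (j * d) := by
      rw [Real.div_rpow hr.le (by positivity), Real.rpow_neg (by positivity : (0 : ℝ) ≤ 4 ^ j),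
        div_inv_eq_mul, pow_mul, ← Real.rpow_natCast _ d]
      exact mul_le_mul_of_nonneg_left
        (Real.rpow_le_rpow_of_exponent_le (one_le_pow₀ (by norm_num)) hγ) (by positivity)
    calc D * 2 ^ j / 4 ^ (j * (d + 1)) * κ * (A * (r / 4 ^ j) ^ (-γ))
        ≤ D * 2 ^ j / 4 ^ (j * (d + 1)) * κ * (A * (r ^ (-γ) * 4 ^ (j * d))) := by gcongr
      _ = D * κ * A * r ^ (-γ) * (1 / 2) ^ j := by
        rw [mul_add, mul_one, pow_add, show (4 : ℝ) ^ j = 2 ^ j * 2 ^ j by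
          rw [← mul_pow]; norm_num, one_div, inv_pow]
        field_simp
  have hbound : ∀ J : ℕ, |∫ᵛ x, f x ∂•a| ≤ 2 * D * κ * A * r ^ (-γ) +
      K * momentConst d * r * (1 / 2) ^ J * V := by
    intro J
    rw [vectorIntegral_eq_sum_add a hf hr (J + 1)]
    refine (abs_add_le _ _).trans (add_le_add ?_ ?_)
    · refine (Finset.abs_sum_le_sum_abs _ _).trans ?_
      refine (Finset.sum_le_sum fun j _ => hterm j).trans ?_
      rw [← Finset.mul_sum]
      have hgeom : ∑ j ∈ Finset.range (J + 1), ((1 : ℝ) / 2) ^ j ≤ 2 := by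
        refine (Summable.sum_le_tsum _ (fun _ _ => by positivity)
          summable_geometric_two).trans tsum_geometric_two.le
      calc D * κ * A * r ^ (-γ) * ∑ j ∈ Finset.range (J + 1), ((1 : ℝ) / 2) ^ j
          ≤ D * κ * A * r ^ (-γ) * 2 := by gcongr
        _ = _ := by ring
    · exact abs_vectorIntegral_le a (by positivity)
        (Eventually.of_forall fun x => abs_heatRemSeq_succ_le hf hr hK hlip J x)
  have hlim : Tendsto (fun J : ℕ => 2 * D * κ * A * r ^ (-γ) +
      K * momentConst d * r * (1 / 2) ^ J * V) atTop
      (𝓝 (2 * D * κ * A * r ^ (-γ) + K * momentConst d * r * 0 * V)) :=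
    (((tendsto_pow_atTop_nhds_zero_of_lt_one (by norm_num) (by norm_num)).const_mul _).mul_const
      _).const_add _
  refine (ge_of_tendsto' hlim hbound).trans (le_of_eq ?_)
  ring

end Iteration

/-! ### Difference bounds for dilated and for smooth functions -/

section SmoothFunctions

theorem lintegral_comp_smul (f : Space d → ℝ≥0∞) {c : ℝ} (hc : 0 < c) (hf : Measurable f) :
    ∫⁻ x, f (c • x) = ENNReal.ofReal ((c ^ d)⁻¹) * ∫⁻ x, f x := by
  rw [← lintegral_map hf (measurable_const_smul c), Measure.map_addHaar_smul _ hc.ne',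
    lintegral_smul_measure, finrank_euclideanSpace, Fintype.card_fin, abs_of_pos (by positivity),
    smul_eq_mul]

/-- The dilation preserves the `L¹` norm and divides each increment by `t`; the reflection reverses
the sign of the increments. -/
theorem DiffBound.dilate {m : ℕ} {f : Space d → ℝ} {K : ℝ≥0∞} (h : DiffBound m f K)
    (hf : Continuous f) {t : ℝ} (ht : 0 < t) (x : Space d) :
    DiffBound m (fun y => (t ^ d)⁻¹ * f (t⁻¹ • (x - y))) (ENNReal.ofReal t⁻¹ ^ m * K) := by
  induction m generalizing f K with
  | zero =>
    rw [pow_zero, one_mul]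
    refine le_trans (le_of_eq ?_) h
    have h1 : ∀ y, ‖(t ^ d)⁻¹ * f (t⁻¹ • (x - y))‖ₑ =
        ENNReal.ofReal ((t ^ d)⁻¹) * ‖f (t⁻¹ • (x - y))‖ₑ := fun y => by
      rw [enorm_mul, Real.enorm_of_nonneg (by positivity)]
    simp_rw [h1]
    rw [lintegral_const_mul' _ _ ENNReal.ofReal_ne_top,
      lintegral_sub_left_eq_self (fun y => ‖f (t⁻¹ • y)‖ₑ) x,
      lintegral_comp_smul (fun y => ‖f y‖ₑ) (inv_pos.2 ht) hf.measurable.enorm, ← mul_assoc,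
      ← ENNReal.ofReal_mul (by positivity), inv_pow, inv_inv,
      inv_mul_cancel₀ (by positivity), ENNReal.ofReal_one, one_mul]
  | succ m ih =>
    intro y
    have h1 := ih (h (-(t⁻¹ • y))) (by fun_prop)
    rw [enorm_neg, enorm_smul, Real.enorm_of_nonneg (by positivity)] at h1
    have e : ‖y‖ₑ * (ENNReal.ofReal t⁻¹ ^ (m + 1) * K) =
        ENNReal.ofReal t⁻¹ ^ m * (ENNReal.ofReal t⁻¹ * ‖y‖ₑ * K) := by ring
    rw [e]
    convert h1 using 2 with z
    rw [mul_sub]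
    congr 1
    simp only
    rw [← sub_add, smul_add, sub_neg_eq_add]

theorem lintegral_enorm_sub_translate_le {E : Type*} [NormedAddCommGroup E] [NormedSpace ℝ E]
    [CompleteSpace E] {g : Space d → E} (hg : ContDiff ℝ 1 g) (y : Space d) :
    ∫⁻ x, ‖g x - g (x - y)‖ₑ ≤ ‖y‖ₑ * ∫⁻ x, ‖fderiv ℝ g x‖ₑ := by
  have hcont : Continuous (fderiv ℝ g) := hg.continuous_fderiv one_ne_zero
  have hpt : ∀ x, ‖g x - g (x - y)‖ₑ ≤
      ∫⁻ s in Set.Ioc (0 : ℝ) 1, ‖y‖ₑ * ‖fderiv ℝ g (x - y + s • y)‖ₑ := by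
    intro x
    have hd : ∀ s ∈ Set.uIcc (0 : ℝ) 1,
        HasDerivAt (fun s : ℝ => g (x - y + s • y)) (fderiv ℝ g (x - y + s • y) y) s := by
      intro s _
      have h1 : HasDerivAt (fun s : ℝ => x - y + s • y) y s := by
        simpa using ((hasDerivAt_id s).smul_const y).const_add (x - y)
      exact ((hg.differentiable one_ne_zero _).hasFDerivAt).comp_hasDerivAt s h1
    have hint := intervalIntegral.integral_eq_sub_of_hasDerivAt hd
      (Continuous.intervalIntegrable (by fun_prop) 0 1)
    simp only [one_smul, sub_add_cancel, zero_smul, add_zero] at hint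
    rw [← hint, intervalIntegral.integral_of_le zero_le_one]
    refine (enorm_integral_le_lintegral_enorm _).trans (lintegral_mono fun s => ?_)
    rw [mul_comm]
    exact ContinuousLinearMap.le_opENorm _ _
  calc ∫⁻ x, ‖g x - g (x - y)‖ₑ
      ≤ ∫⁻ x, ∫⁻ s in Set.Ioc (0 : ℝ) 1, ‖y‖ₑ * ‖fderiv ℝ g (x - y + s • y)‖ₑ :=
        lintegral_mono hpt
    _ = ∫⁻ s in Set.Ioc (0 : ℝ) 1, (∫⁻ x, ‖y‖ₑ * ‖fderiv ℝ g (x - y + s • y)‖ₑ) := by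
        refine lintegral_lintegral_swap (μ := volume)
          (f := fun (x : Space d) (s : ℝ) => ‖y‖ₑ * ‖fderiv ℝ g (x - y + s • y)‖ₑ) ?_
        refine Measurable.aemeasurable ?_
        simp only [Function.uncurry_def]
        exact (hcont.comp (by fun_prop : Continuous fun p : Space d × ℝ =>
          p.1 - y + p.2 • y)).enorm.measurable.const_mul _
    _ = ∫⁻ _s in Set.Ioc (0 : ℝ) 1, (‖y‖ₑ * ∫⁻ x, ‖fderiv ℝ g x‖ₑ) := by
        refine lintegral_congr fun s => ?_
        rw [lintegral_const_mul' _ _ enorm_ne_top]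
        congr 1
        have := lintegral_sub_right_eq_self (μ := volume) (fun x => ‖fderiv ℝ g x‖ₑ) (y - s • y)
        rw [← this]
        refine lintegral_congr fun x => ?_
        congr 2
        abel
    _ = _ := by simp

/-- Differences commute with derivatives, and each difference is controlled in `L¹` by one more
derivative. -/
theorem diffBound_of_contDiff {f : Space d → ℝ} (m : ℕ) (hf : ContDiff ℝ m f) :
    DiffBound m f (∫⁻ x, ‖iteratedFDeriv ℝ m f x‖ₑ) := by
  induction m generalizing f with
  | zero =>
    refine lintegral_mono fun x => le_of_eq ?_
    rw [← ofReal_norm, ← ofReal_norm, norm_iteratedFDeriv_zero]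
  | succ m ih =>
    intro y
    have hfm : ContDiff ℝ m f := hf.of_le (by exact_mod_cast Nat.le_succ m)
    have hfy : ContDiff ℝ m fun x => f (x - y) := hfm.comp (contDiff_id.sub contDiff_const)
    refine (ih (hfm.sub hfy)).mono ?_
    have h1 : ContDiff ℝ 1 (iteratedFDeriv ℝ m f) := by
      refine hf.iteratedFDeriv_right ?_
      push_cast
      exact (add_comm _ _).le
    refine le_trans (le_of_eq ?_) ((lintegral_enorm_sub_translate_le h1 y).trans (le_of_eq ?_))
    · refine lintegral_congr fun x => ?_
      rw [show (fun x => f x - f (x - y)) = f - fun x => f (x - y) from rfl,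
        iteratedFDeriv_sub_apply hfm.contDiffAt hfy.contDiffAt, iteratedFDeriv_comp_sub]
    · congr 1
      refine lintegral_congr fun x => ?_
      rw [← ofReal_norm, ← ofReal_norm, norm_fderiv_iteratedFDeriv]

end SmoothFunctions

/-! ### Quantitative bounds for the dilated test functions -/

section TestFunctions

/-- The seminorms that control the test functions of the grand maximal function. -/
def testSeminorms (d : ℕ) : Finset (ℕ × ℕ) := Finset.Iic (d + 1, d + 1)

theorem one_add_norm_pow_mul_le {F : Finset (ℕ × ℕ)} (hF : testSeminorms d ⊆ F)
    {Φ : 𝓢(Space d, ℝ)} (hΦ : F.sup (schwartzSeminormFamily ℝ (Space d) ℝ) Φ ≤ 1) {k n : ℕ}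
    (hk : k ≤ d + 1) (hn : n ≤ d + 1) (x : Space d) :
    (1 + ‖x‖) ^ k * ‖iteratedFDeriv ℝ n Φ x‖ ≤ 2 ^ (d + 1) := by
  refine (SchwartzMap.one_add_le_sup_seminorm_apply (𝕜 := ℝ) (m := (d + 1, d + 1)) hk hn
    Φ x).trans (mul_le_of_le_one_right (by positivity) (le_trans ?_ hΦ))
  exact Seminorm.le_def.1 (Finset.sup_mono (f := schwartzSeminormFamily ℝ (Space d) ℝ) hF) Φ

/-- A bound for the `L¹` norms of the derivatives of the test functions. -/
noncomputable def testConst (d : ℕ) : ℝ :=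
  2 ^ (d + 1) * ∫ x : Space d, (1 + ‖x‖) ^ (-((d : ℝ) + 1))

theorem testConst_nonneg (d : ℕ) : 0 ≤ testConst d :=
  mul_nonneg (by positivity) (integral_nonneg fun _ => by positivity)

theorem lintegral_iteratedFDeriv_le {F : Finset (ℕ × ℕ)} (hF : testSeminorms d ⊆ F)
    {Φ : 𝓢(Space d, ℝ)} (hΦ : F.sup (schwartzSeminormFamily ℝ (Space d) ℝ) Φ ≤ 1) {n : ℕ}
    (hn : n ≤ d + 1) :
    ∫⁻ x, ‖iteratedFDeriv ℝ n Φ x‖ₑ ≤ ENNReal.ofReal (testConst d) := by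
  have hint : Integrable (fun x : Space d => (1 + ‖x‖) ^ (-((d : ℝ) + 1))) :=
    integrable_one_add_norm (by simp)
  rw [testConst, ← integral_const_mul, ofReal_integral_eq_lintegral_ofReal (hint.const_mul _)
    (Eventually.of_forall fun x => by positivity)]
  refine lintegral_mono fun x => ?_
  rw [← ofReal_norm]
  refine ENNReal.ofReal_le_ofReal ?_
  have h := one_add_norm_pow_mul_le hF hΦ le_rfl hn x
  rw [Real.rpow_neg (by positivity), ← div_eq_mul_inv, le_div_iff₀ (by positivity), mul_comm]
  exact_mod_cast h

/-- The dilated and reflected test function in the definition of `convDilate`. -/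
noncomputable def dilate (Φ : 𝓢(Space d, ℝ)) (t : ℝ) (x : Space d) (y : Space d) : ℝ :=
  (t ^ d)⁻¹ * Φ (t⁻¹ • (x - y))

theorem norm_fderiv_le {F : Finset (ℕ × ℕ)} (hF : testSeminorms d ⊆ F)
    {Φ : 𝓢(Space d, ℝ)} (hΦ : F.sup (schwartzSeminormFamily ℝ (Space d) ℝ) Φ ≤ 1)
    (x : Space d) : (1 + ‖x‖) ^ (d + 1) * ‖fderiv ℝ Φ x‖ ≤ 2 ^ (d + 1) := by
  have := one_add_norm_pow_mul_le hF hΦ le_rfl (Nat.le_add_left 1 d) x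
  rwa [← norm_fderiv_iteratedFDeriv, norm_fderiv_iteratedFDeriv, norm_iteratedFDeriv_one] at this

theorem isBddContinuous_dilate (Φ : 𝓢(Space d, ℝ)) {t : ℝ} (ht : 0 < t) (x : Space d) :
    IsBddContinuous (dilate Φ t x) := by
  refine ⟨?_, (t ^ d)⁻¹ * SchwartzMap.seminorm ℝ 0 0 Φ, fun y => ?_⟩
  · unfold dilate
    have := Φ.continuous
    fun_prop
  · rw [dilate, abs_mul, abs_of_pos (by positivity)]
    refine mul_le_mul_of_nonneg_left ?_ (by positivity)
    simpa using SchwartzMap.norm_le_seminorm ℝ Φ (t⁻¹ • (x - y))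

theorem hasFDerivAt_dilate (Φ : 𝓢(Space d, ℝ)) (t : ℝ) (x y : Space d) :
    HasFDerivAt (dilate Φ t x) (-((t ^ d)⁻¹ * t⁻¹) • fderiv ℝ Φ (t⁻¹ • (x - y))) y := by
  have h1 : HasFDerivAt (fun y : Space d => t⁻¹ • (x - y))
      (t⁻¹ • (-ContinuousLinearMap.id ℝ (Space d))) y :=
    ((hasFDerivAt_id y).const_sub x).const_smul t⁻¹
  have h2 := (Φ.differentiableAt (x := t⁻¹ • (x - y))).hasFDerivAt.comp y h1
  have h3 := h2.const_mul ((t ^ d)⁻¹)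
  refine h3.congr_fderiv ?_
  ext v
  simp
  ring

theorem norm_fderiv_dilate_le {F : Finset (ℕ × ℕ)} (hF : testSeminorms d ⊆ F)
    {Φ : 𝓢(Space d, ℝ)} (hΦ : F.sup (schwartzSeminormFamily ℝ (Space d) ℝ) Φ ≤ 1) {t : ℝ}
    (ht : 0 < t) (x y : Space d) :
    ‖-((t ^ d)⁻¹ * t⁻¹) • fderiv ℝ Φ (t⁻¹ • (x - y))‖ ≤
      (t ^ d)⁻¹ * t⁻¹ * (2 ^ (d + 1) / (1 + t⁻¹ * ‖x - y‖) ^ (d + 1)) := by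
  have h := norm_fderiv_le hF hΦ (t⁻¹ • (x - y))
  rw [norm_smul, norm_neg, Real.norm_of_nonneg (by positivity)]
  refine mul_le_mul_of_nonneg_left ?_ (by positivity)
  rw [norm_smul, Real.norm_of_nonneg (by positivity)] at h
  rw [le_div_iff₀ (by positivity), mul_comm]
  exact h

theorem abs_dilate_sub_le {F : Finset (ℕ × ℕ)} (hF : testSeminorms d ⊆ F)
    {Φ : 𝓢(Space d, ℝ)} (hΦ : F.sup (schwartzSeminormFamily ℝ (Space d) ℝ) Φ ≤ 1) {t : ℝ}
    (ht : 0 < t) (x u y : Space d) :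
    |dilate Φ t x u - dilate Φ t x (u - y)| ≤ (t ^ d)⁻¹ * t⁻¹ * 2 ^ (d + 1) * ‖y‖ := by
  have h := convex_univ.norm_image_sub_le_of_norm_hasFDerivWithin_le
    (C := (t ^ d)⁻¹ * t⁻¹ * 2 ^ (d + 1))
    (fun y _ => (hasFDerivAt_dilate Φ t x y).hasFDerivWithinAt)
    (fun y _ => (norm_fderiv_dilate_le hF hΦ ht x y).trans ?_)
    (Set.mem_univ (u - y)) (Set.mem_univ u)
  · simpa using h
  · refine mul_le_mul_of_nonneg_left (div_le_self (by positivity) ?_) (by positivity)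
    exact one_le_pow₀ (le_add_of_nonneg_right (by positivity))

theorem diffBound_dilate {F : Finset (ℕ × ℕ)} (hF : testSeminorms d ⊆ F)
    {Φ : 𝓢(Space d, ℝ)} (hΦ : F.sup (schwartzSeminormFamily ℝ (Space d) ℝ) Φ ≤ 1) {t : ℝ}
    (ht : 0 < t) (x : Space d) {n : ℕ} (hn : n ≤ d + 1) :
    DiffBound n (dilate Φ t x) (ENNReal.ofReal (t⁻¹ ^ n * testConst d)) := by
  have h := ((diffBound_of_contDiff n (Φ.smooth n)).mono
    (lintegral_iteratedFDeriv_le hF hΦ hn)).dilate Φ.continuous ht x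
  rw [ENNReal.ofReal_mul (by positivity), ENNReal.ofReal_pow (by positivity)]
  exact h

/-- The dilated test function as a continuous function vanishing at infinity. -/
noncomputable def dilateC0 (Φ : 𝓢(Space d, ℝ)) {t : ℝ} (ht : 0 < t) (x : Space d) :
    C₀(Space d, ℝ) where
  toFun := dilate Φ t x
  continuous_toFun := (isBddContinuous_dilate Φ ht x).1
  zero_at_infty' := by
    have h1 : Tendsto (fun y : Space d => t⁻¹ • (x - y)) (cocompact _) (cocompact _) :=
      ((Homeomorph.subLeft x).trans
        (Homeomorph.smulOfNeZero t⁻¹ (inv_pos.2 ht).ne')).isClosedEmbedding.tendsto_cocompact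
    have h2 := (Φ.toZeroAtInfty.zero_at_infty'.comp h1).const_mul ((t ^ d)⁻¹)
    rw [mul_zero] at h2
    exact h2

end TestFunctions

/-! ### Pointwise bounds for one atom, near its cube and away from it -/

section Atoms

theorem norm_sub_le_of_mem_cube {c x : Space d} {l : ℝ} (hl : 0 ≤ l) (hx : x ∈ cube c l) :
    ‖x - c‖ ≤ d * l := by
  refine (EuclideanSpace.norm_eq _).le.trans (Real.sqrt_le_iff.2 ⟨by positivity, ?_⟩)
  calc ∑ j, ‖(x - c) j‖ ^ 2 ≤ ∑ _j : Fin d, l ^ 2 := by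
        refine Finset.sum_le_sum fun j _ => pow_le_pow_left₀ (norm_nonneg _) ?_ 2
        have h := hx j
        rw [Real.norm_eq_abs, abs_le]
        exact ⟨by simp; linarith [h.1], by simp; linarith [h.2]⟩
    _ = d * l ^ 2 := by simp
    _ ≤ (d : ℝ) ^ 2 * l ^ 2 := by
        refine mul_le_mul_of_nonneg_right ?_ (by positivity)
        exact_mod_cast Nat.le_self_pow two_ne_zero d
    _ = _ := by ring

theorem measurableSet_cube (c : Space d) (l : ℝ) : MeasurableSet (cube c l) := by
  have : cube c l = ⋂ j, {x : Space d | x j ∈ Set.Icc (c j) (c j + l)} := by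
    ext x; simp [cube]
  rw [this]
  refine MeasurableSet.iInter fun j => ?_
  exact measurableSet_Icc.preimage (by fun_prop : Continuous fun x : Space d => x j).measurable

/-- Time `s ^ 2` turns the exponent `(d - β) / 2` of the heat bound into the scale exponent `d - β`,
which then cancels against the power of `t`. -/
theorem abs_convDilate_near {β : ℝ} (hβ : 0 < β) {a : FinRadon d} {A : ℝ}
    (ha : ∀ (x : Space d) (t : ℝ), 0 < t → |t ^ (((d : ℝ) - β) / 2) * heatExt a t x| ≤ A)
    {F : Finset (ℕ × ℕ)} (hF : testSeminorms d ⊆ F)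
    {Φ : 𝓢(Space d, ℝ)} (hΦ : F.sup (schwartzSeminormFamily ℝ (Space d) ℝ) Φ ≤ 1) {t : ℝ}
    (ht : 0 < t) (x : Space d) :
    t ^ ((d : ℝ) - β) * |convDilate a Φ t x| ≤
      2 * decayConst d (d + 1) * testConst d * A := by
  have hA : ∀ s z, 0 < s → |heatExt a (s ^ 2) z| ≤ A * s ^ (-((d : ℝ) - β)) := by
    intro s z hs
    have h := ha z (s ^ 2) (by positivity)
    have e : (s ^ 2) ^ (((d : ℝ) - β) / 2) = s ^ ((d : ℝ) - β) := by
      rw [← Real.rpow_natCast, ← Real.rpow_mul hs.le]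
      congr 1
      push_cast
      ring
    rw [e, abs_mul, abs_of_pos (by positivity)] at h
    rw [Real.rpow_neg hs.le, ← div_eq_mul_inv, le_div_iff₀ (by positivity), mul_comm]
    exact h
  have h0 := diffBound_dilate hF hΦ ht x (Nat.zero_le _)
  rw [pow_zero, one_mul] at h0
  have h := abs_vectorIntegral_le_of_heatExt_le a (γ := (d : ℝ) - β) (by linarith) hA
    (testConst_nonneg d) (isBddContinuous_dilate Φ ht x) ht (by positivity)
    (abs_dilate_sub_le hF hΦ ht x) h0 (diffBound_dilate hF hΦ ht x le_rfl)
  rw [Real.rpow_neg ht.le, ← div_eq_mul_inv, le_div_iff₀ (by positivity), mul_comm] at h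
  exact h

theorem abs_convDilate_far {β : ℝ} (hβ : 0 < β) (hβd : β ≤ d) {a : FinRadon d} {c : Space d}
    {l : ℝ} (hl : 0 < l) (hsupp : a.totalVariation (cube c l)ᶜ = 0) (hmean : a (cube c l) = 0)
    (hmass : a.totalVariation Set.univ ≤ 1)
    {F : Finset (ℕ × ℕ)} (hF : testSeminorms d ⊆ F)
    {Φ : 𝓢(Space d, ℝ)} (hΦ : F.sup (schwartzSeminormFamily ℝ (Space d) ℝ) Φ ≤ 1) {t : ℝ}
    (ht : 0 < t) {x : Space d} {ρ : ℝ} (hρ : 0 < ρ) (hlρ : d * l ≤ ρ) (hx : 2 * ρ ≤ ‖x - c‖) :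
    t ^ ((d : ℝ) - β) * |convDilate a Φ t x| ≤ 2 ^ (d + 1) * (d * l) * ρ ^ (-(β + 1)) := by
  set ψ := dilate Φ t x with hψ
  set C := (t ^ d)⁻¹ * t⁻¹ * (2 ^ (d + 1) / (1 + t⁻¹ * ρ) ^ (d + 1)) with hC
  have hC0 : 0 ≤ C := by positivity
  have hosc : ∀ y ∈ cube c l, |ψ y - ψ c| ≤ C * (d * l) := by
    intro y hy
    have hyc := norm_sub_le_of_mem_cube hl.le hy
    have h := (convex_closedBall c (d * l)).norm_image_sub_le_of_norm_hasFDerivWithin_le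
      (C := C) (fun y _ => (hasFDerivAt_dilate Φ t x y).hasFDerivWithinAt)
      (fun z hz => (norm_fderiv_dilate_le hF hΦ ht x z).trans ?_)
      (Metric.mem_closedBall_self (by positivity))
      (show y ∈ Metric.closedBall c (d * l) by rwa [Metric.mem_closedBall, dist_eq_norm])
    · exact h.trans (mul_le_mul_of_nonneg_left hyc hC0)
    · rw [Metric.mem_closedBall, dist_eq_norm] at hz
      have h1 : ρ ≤ ‖x - z‖ := by
        have h2 := norm_add_le (x - z) (z - c)
        rw [sub_add_sub_cancel] at h2
        linarith
      rw [hC]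
      gcongr
  have hbdd : IsBddContinuous ψ := isBddContinuous_dilate Φ ht x
  have huniv : a Set.univ = 0 := by
    rw [← Set.union_compl_self (cube c l), VectorMeasure.of_union disjoint_compl_right
      (measurableSet_cube c l) (measurableSet_cube c l).compl, hmean,
      SignedMeasure.null_of_totalVariation_zero a hsupp, add_zero]
  have : IsFiniteMeasure a.variation := by
    rw [← SignedMeasure.totalVariation_eq_variation]; infer_instance
  have hconst : IsBddContinuous fun _ : Space d => ψ c := ⟨continuous_const, |ψ c|, fun _ => le_rfl⟩
  have hsub : convDilate a Φ t x = ∫ᵛ y, (ψ y - ψ c) ∂•a := by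
    rw [VectorMeasure.integral_fun_sub (vectorIntegrable a hbdd) (vectorIntegrable a hconst),
      VectorMeasure.integral_const, huniv, map_zero, sub_zero]
    rfl
  have hmain : |convDilate a Φ t x| ≤ C * (d * l) := by
    rw [hsub]
    refine (abs_vectorIntegral_le a (B := C * (d * l)) (by positivity) ?_).trans
      (mul_le_of_le_one_right (by positivity) ?_)
    · have : ∀ᵐ y ∂a.totalVariation, y ∈ cube c l := by
        rw [ae_iff]; exact hsupp
      exact this.mono hosc
    · exact ENNReal.toReal_le_of_le_ofReal zero_le_one (by simpa using hmass)
  -- The powers of `t` combine to `t ^ (-(β + 1))`. Since `β ≤ d`, the decay of order `d + 1`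
  -- dominates `(ρ / t) ^ (β + 1)`, which removes `t`.
  have hpow : t ^ ((d : ℝ) - β) * ((t ^ d)⁻¹ * t⁻¹ * ((1 + t⁻¹ * ρ) ^ (d + 1))⁻¹) ≤
      ρ ^ (-(β + 1)) := by
    have h1 : (t⁻¹ * ρ) ^ (β + 1) ≤ (1 + t⁻¹ * ρ) ^ (d + 1) := by
      rw [← Real.rpow_natCast]
      refine (Real.rpow_le_rpow (by positivity) (by linarith : t⁻¹ * ρ ≤ 1 + t⁻¹ * ρ)
        (by linarith)).trans (Real.rpow_le_rpow_of_exponent_le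
          (le_add_of_nonneg_right (by positivity)) ?_)
      push_cast
      linarith
    have h2 : t ^ ((d : ℝ) - β) * ((t ^ d)⁻¹ * t⁻¹) = (t⁻¹) ^ (β + 1) := by
      rw [Real.inv_rpow ht.le, ← Real.rpow_neg ht.le, ← mul_inv, ← pow_succ, ← Real.rpow_natCast,
        ← Real.rpow_neg ht.le, ← Real.rpow_add ht]
      congr 1
      push_cast
      ring
    rw [← mul_assoc, h2, ← div_eq_mul_inv, div_le_iff₀ (by positivity), Real.rpow_neg hρ.le]
    rw [Real.mul_rpow (by positivity) hρ.le] at h1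
    rw [inv_mul_eq_div, le_div_iff₀ (by positivity)]
    exact h1
  calc t ^ ((d : ℝ) - β) * |convDilate a Φ t x| ≤ t ^ ((d : ℝ) - β) * (C * (d * l)) := by gcongr
    _ = 2 ^ (d + 1) * (d * l) *
        (t ^ ((d : ℝ) - β) * ((t ^ d)⁻¹ * t⁻¹ * ((1 + t⁻¹ * ρ) ^ (d + 1))⁻¹)) := by
        rw [hC]; ring
    _ ≤ _ := mul_le_mul_of_nonneg_left hpow (by positivity)

end Atoms

/-! ### Content bound for the maximal function of an atom, and passage to the limit -/

/-- The constant in the pointwise bound for the grand maximal function of an atom. -/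
noncomputable def atomConst (d : ℕ) (β : ℝ) : ℝ :=
  2 ^ (d + 1) * 2 ^ (β + 1) + 2 * decayConst d (d + 1) * testConst d * (d : ℝ) ^ β

theorem atomConst_pos (d : ℕ) (β : ℝ) : 0 < atomConst d β := by
  have := decayConst_pos d (d + 1)
  have := testConst_nonneg d
  unfold atomConst
  positivity

/-- The constant in the bound for the Choquet integral of the grand maximal function of an atom. -/
noncomputable def atomContentConst (d : ℕ) (β : ℝ) : ℝ :=
  2 * (atomConst d β * (3 ^ d * 2 ^ β * 2 ^ β))

/-- The weights in the bound for the grand maximal function of an atom. -/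
noncomputable def atomWeight (d : ℕ) (β R : ℝ) (k : ℕ) : ℝ :=
  atomConst d β * R ^ (-β) * ((2 : ℝ) ^ k) ^ (-(β + 1))

theorem atomWeight_nonneg (d : ℕ) (β : ℝ) {R : ℝ} (hR : 0 ≤ R) (k : ℕ) :
    0 ≤ atomWeight d β R k := by
  have := atomConst_pos d β
  unfold atomWeight
  positivity

/-- The content grows like `(2 ^ k * R) ^ β`, and the extra power `-1` in the weight, due to the
vanishing mean, leaves `(1 / 2) ^ k`. -/
theorem atomWeight_mul_dyadicContent_le {β : ℝ} (hβ : 0 < β) {R : ℝ} (hR : 0 < R) (c : Space d)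
    (k : ℕ) :
    ((atomWeight d β R k).toNNReal : ℝ≥0∞) * dyadicContent β (Metric.ball c (2 * 2 ^ k * R)) ≤
      ENNReal.ofReal (atomConst d β * (3 ^ d * 2 ^ β * 2 ^ β) * (1 / 2) ^ k) := by
  have hE := atomConst_pos d β
  refine (mul_le_mul_right (dyadicContent_ball_le hβ c (by positivity)) _).trans ?_
  change ENNReal.ofReal _ * _ ≤ _
  rw [← ENNReal.ofReal_mul (atomWeight_nonneg d β hR.le k)]
  refine ENNReal.ofReal_le_ofReal (le_of_eq ?_)
  have hk : (0 : ℝ) < 2 ^ k := by positivity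
  rw [atomWeight, Real.mul_rpow (by positivity) hR.le, Real.mul_rpow (by norm_num) hk.le,
    Real.rpow_neg hR.le, Real.rpow_neg hk.le, Real.rpow_add hk, Real.rpow_one, one_div, inv_pow]
  have h1 : (0 : ℝ) < R ^ β := Real.rpow_pos_of_pos hR β
  have h2 : (0 : ℝ) < ((2 : ℝ) ^ k) ^ β := Real.rpow_pos_of_pos hk β
  field_simp

theorem tsum_atomWeight_mul_le {β : ℝ} (hβ : 0 < β) {R : ℝ} (hR : 0 < R) (c : Space d) :
    ∑' k : ℕ, ((atomWeight d β R k).toNNReal : ℝ≥0∞) *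
        dyadicContent β (Metric.ball c (2 * 2 ^ k * R)) ≤
      ENNReal.ofReal (atomContentConst d β) := by
  have hE := atomConst_pos d β
  refine (ENNReal.tsum_le_tsum fun k => atomWeight_mul_dyadicContent_le hβ hR c k).trans ?_
  rw [← ENNReal.ofReal_tsum_of_nonneg (fun k => by positivity)
    (summable_geometric_two.mul_left _), tsum_mul_left, tsum_geometric_two, atomContentConst,
    mul_comm]

theorem convDilate_atom_le {β : ℝ} (hβ : 0 < β) (hβd : β ≤ d) {a : FinRadon d} {c : Space d}
    {l : ℝ} (hl : 0 < l) (hsupp : a.totalVariation (cube c l)ᶜ = 0) (hmean : a (cube c l) = 0)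
    (hheat : ∀ (x : Space d) (t : ℝ), 0 < t →
      |t ^ (((d : ℝ) - β) / 2) * heatExt a t x| ≤ 1 / l ^ β)
    (hmass : a.totalVariation Set.univ ≤ 1)
    {F : Finset (ℕ × ℕ)} (hF : testSeminorms d ⊆ F)
    {Φ : 𝓢(Space d, ℝ)} (hΦ : F.sup (schwartzSeminormFamily ℝ (Space d) ℝ) Φ ≤ 1) {t : ℝ}
    (ht : 0 < t) (x : Space d) :
    ∃ k : ℕ, x ∈ Metric.ball c (2 * 2 ^ k * (d * l)) ∧
      t ^ ((d : ℝ) - β) * |convDilate a Φ t x| ≤ atomWeight d β (d * l) k := by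
  have hd : (0 : ℝ) < d := hβ.trans_le hβd
  have hR : 0 < (d : ℝ) * l := by positivity
  have hD := decayConst_pos d (d + 1)
  have hT := testConst_nonneg d
  have hex : ∃ k : ℕ, x ∈ Metric.ball c (2 * 2 ^ k * (d * l)) := by
    obtain ⟨k, hk⟩ := pow_unbounded_of_one_lt (dist x c / (2 * (d * l))) one_lt_two
    refine ⟨k, ?_⟩
    rw [div_lt_iff₀ (by positivity)] at hk
    rw [Metric.mem_ball]
    linarith
  classical
  -- The smallest ball containing `x` is used: index `0` calls for the near bound, and for index `k
  -- + 1` the point lies outside the ball of index `k`, so the far bound applies with `ρ = 2 ^ k *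
  -- (d * l)`.
  refine ⟨Nat.find hex, Nat.find_spec hex, ?_⟩
  rcases hfind : Nat.find hex with _ | k
  · refine (abs_convDilate_near hβ hheat hF hΦ ht x).trans ?_
    have h1 : (d : ℝ) ^ β * ((d : ℝ) * l) ^ (-β) = 1 / l ^ β := by
      rw [Real.rpow_neg hR.le, Real.mul_rpow hd.le hl.le]
      have := Real.rpow_pos_of_pos hd β
      have := Real.rpow_pos_of_pos hl β
      field_simp
    rw [atomWeight, pow_zero, Real.one_rpow, mul_one, ← h1, ← mul_assoc]
    refine mul_le_mul_of_nonneg_right ?_ (by positivity)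
    rw [atomConst]
    exact le_add_of_nonneg_left (by positivity)
  · have hnot := Nat.find_min hex (m := k) (by omega)
    rw [Metric.mem_ball, dist_eq_norm, not_lt] at hnot
    have hk : (1 : ℝ) ≤ 2 ^ k := one_le_pow₀ (by norm_num)
    refine (abs_convDilate_far hβ hβd hl hsupp hmean hmass hF hΦ ht (x := x)
      (ρ := 2 ^ k * (d * l)) (by positivity) (le_mul_of_one_le_left hR.le hk)
      (by linarith)).trans ?_
    have e : (2 : ℝ) ^ (d + 1) * (d * l) * (2 ^ k * (d * l)) ^ (-(β + 1)) =
        2 ^ (d + 1) * 2 ^ (β + 1) * (d * l) ^ (-β) * ((2 : ℝ) ^ (k + 1)) ^ (-(β + 1)) := by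
      rw [pow_succ (2 : ℝ) k, Real.mul_rpow (by positivity) hR.le,
        Real.mul_rpow (by positivity) two_pos.le, Real.rpow_neg two_pos.le,
        show -(β + 1) = -β + -1 by ring, Real.rpow_add hR, Real.rpow_neg_one]
      have := Real.rpow_pos_of_pos two_pos (β + 1)
      field_simp
    rw [e, atomWeight]
    refine mul_le_mul_of_nonneg_right (mul_le_mul_of_nonneg_right ?_ (by positivity))
      (by positivity)
    rw [atomConst]
    exact le_add_of_nonneg_right (by positivity)

/-- The grand maximal function of an atom is controlled by a combination of indicator functions
of balls with controlled total content. -/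
theorem IsAtom.exists_grandMaximal_le {β : ℝ} (hβ : 0 < β) (hβd : β ≤ d) {a : FinRadon d}
    (ha : IsAtom β a) :
    ∃ (w : ℕ → ℝ≥0) (A : ℕ → Set (Space d)),
      (∀ F : Finset (ℕ × ℕ), testSeminorms d ⊆ F → ∀ x, grandMaximal F ((d : ℝ) - β) a x ≤
        ∑' k, (A k).indicator (fun _ => (w k : ℝ≥0∞)) x) ∧
      ∑' k, w k * dyadicContent β (A k) ≤ ENNReal.ofReal (atomContentConst d β) := by
  obtain ⟨c, l, hl, hsupp, hmean, hheat, hmass⟩ := ha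
  have hd : (0 : ℝ) < d := hβ.trans_le hβd
  refine ⟨fun k => (atomWeight d β (d * l) k).toNNReal,
    fun k => Metric.ball c (2 * 2 ^ k * (d * l)), fun F hF x => ?_,
    tsum_atomWeight_mul_le hβ (by positivity) c⟩
  refine iSup₂_le fun Φ hΦ => iSup₂_le fun t ht => ?_
  obtain ⟨k, hk, hle⟩ := convDilate_atom_le hβ hβd hl hsupp hmean hheat hmass hF hΦ ht x
  refine le_trans ?_ (ENNReal.le_tsum k)
  rw [Set.indicator_of_mem hk]
  exact ENNReal.ofReal_le_ofReal hle

/-- For fixed `Φ` and `t` the convolutions converge, by weak-star convergence tested on `dilateC0`;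
the supremum is taken only afterwards. -/
theorem grandMaximal_le_liminf {β γ : ℝ} {μ : FinRadon d} {c : ℕ → ℕ → ℝ}
    {a : ℕ → ℕ → FinRadon d} (h : IsAtomicLimit β μ c a) (F : Finset (ℕ × ℕ)) (x : Space d) :
    grandMaximal F γ μ x ≤ liminf (fun n => ∑ i ∈ Finset.range n,
      ENNReal.ofReal |c n i| * grandMaximal F γ (a n i) x) atTop := by
  refine iSup₂_le fun Φ hΦ => iSup₂_le fun t ht => ?_
  have hlim := h.2 (dilateC0 Φ ht x)
  change Tendsto (fun n => ∑ i ∈ Finset.range n, c n i * convDilate (a n i) Φ t x) atTop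
    (𝓝 (convDilate μ Φ t x)) at hlim
  have hlim' := (ENNReal.continuous_ofReal.tendsto _).comp ((hlim.abs).const_mul (t ^ γ))
  rw [← hlim'.liminf_eq]
  refine liminf_le_liminf (Eventually.of_forall fun n => ?_)
  simp only [Function.comp_apply]
  calc ENNReal.ofReal (t ^ γ * |∑ i ∈ Finset.range n, c n i * convDilate (a n i) Φ t x|)
      ≤ ENNReal.ofReal (∑ i ∈ Finset.range n, |c n i| * (t ^ γ * |convDilate (a n i) Φ t x|)) := by
        refine ENNReal.ofReal_le_ofReal ?_
        refine (mul_le_mul_of_nonneg_left (Finset.abs_sum_le_sum_abs _ _) (by positivity)).trans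
          (le_of_eq ?_)
        rw [Finset.mul_sum]
        refine Finset.sum_congr rfl fun i _ => ?_
        rw [abs_mul]
        ring
    _ = ∑ i ∈ Finset.range n, ENNReal.ofReal |c n i| *
          ENNReal.ofReal (t ^ γ * |convDilate (a n i) Φ t x|) := by
        rw [ENNReal.ofReal_sum_of_nonneg fun i _ => by positivity]
        exact Finset.sum_congr rfl fun i _ => ENNReal.ofReal_mul (abs_nonneg _)
    _ ≤ _ := by
        refine Finset.sum_le_sum fun i _ => mul_le_mul_right ?_ _
        exact le_iSup₂_of_le Φ hΦ (le_iSup₂_of_le t ht le_rfl)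

theorem choquet_sum_grandMaximal_le {β : ℝ} (hβ : 0 < β) (hβd : β ≤ d) {F : Finset (ℕ × ℕ)}
    (hF : testSeminorms d ⊆ F) (n : ℕ) (c : ℕ → ℝ) {a : ℕ → FinRadon d}
    (ha : ∀ i < n, IsAtom β (a i)) :
    choquet (dyadicContent β) (fun x => ∑ i ∈ Finset.range n,
        ENNReal.ofReal |c i| * grandMaximal F ((d : ℝ) - β) (a i) x) ≤
      ENNReal.ofReal (atomContentConst d β) * ∑ i ∈ Finset.range n, ENNReal.ofReal |c i| := by
  have hh := isCapacity_dyadicContent (d := d) hβ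
  have hex := fun i (hi : i < n) => (ha i hi).exists_grandMaximal_le hβ hβd
  choose! w A hwA hsum using hex
  have hpt : ∀ x, ∑ i ∈ Finset.range n, ENNReal.ofReal |c i| *
      grandMaximal F ((d : ℝ) - β) (a i) x ≤
      ∑ i ∈ Finset.range n, ∑' k, (A i k).indicator
        (fun _ => ((|c i|.toNNReal * w i k : ℝ≥0) : ℝ≥0∞)) x := by
    intro x
    refine Finset.sum_le_sum fun i hi => ?_
    refine (mul_le_mul_right (hwA i (Finset.mem_range.1 hi) F hF x) _).trans (le_of_eq ?_)
    rw [← ENNReal.tsum_mul_left]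
    refine tsum_congr fun k => ?_
    by_cases hx : x ∈ A i k
    · simp [hx, ENNReal.ofReal]
    · simp [hx]
  refine (hh.choquet_mono hpt).trans ((hh.choquet_sum_tsum_indicator_le n _ A).trans ?_)
  rw [Finset.mul_sum]
  refine Finset.sum_le_sum fun i hi => ?_
  simp_rw [ENNReal.coe_mul, mul_assoc]
  rw [ENNReal.tsum_mul_left, mul_comm]
  exact mul_le_mul_left (hsum i (Finset.mem_range.1 hi)) _

theorem choquetIntegral_grandMaximal_le {β : ℝ} (hβ : 0 < β) (hβd : β ≤ d) {F : Finset (ℕ × ℕ)}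
    (hF : testSeminorms d ⊆ F) {μ : FinRadon d} {c : ℕ → ℕ → ℝ} {a : ℕ → ℕ → FinRadon d}
    (h : IsAtomicLimit β μ c a) :
    choquetIntegral β (grandMaximal F ((d : ℝ) - β) μ) ≤
      ENNReal.ofReal (omega β * ((d : ℝ) + 1) ^ β * atomContentConst d β) * coeffLimsup c := by
  have hω := omega_pos hβ
  have hh := isCapacity_dyadicContent (d := d) hβ
  rw [ENNReal.ofReal_mul (by positivity), mul_assoc]
  refine (choquetIntegral_le_choquet hβ _).trans (mul_le_mul_right ?_ _)
  calc choquet (dyadicContent β) (grandMaximal F ((d : ℝ) - β) μ)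
      ≤ choquet (dyadicContent β) (fun x => liminf (fun n => ∑ i ∈ Finset.range n,
          ENNReal.ofReal |c n i| * grandMaximal F ((d : ℝ) - β) (a n i) x) atTop) :=
        hh.choquet_mono (grandMaximal_le_liminf h F)
    _ ≤ liminf (fun n => choquet (dyadicContent β) (fun x => ∑ i ∈ Finset.range n,
          ENNReal.ofReal |c n i| * grandMaximal F ((d : ℝ) - β) (a n i) x)) atTop :=
        hh.choquet_liminf_le _
    _ ≤ limsup (fun n => choquet (dyadicContent β) (fun x => ∑ i ∈ Finset.range n,
          ENNReal.ofReal |c n i| * grandMaximal F ((d : ℝ) - β) (a n i) x)) atTop :=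
        liminf_le_limsup
    _ ≤ limsup (fun n => ENNReal.ofReal (atomContentConst d β) *
          ∑ i ∈ Finset.range n, ENNReal.ofReal |c n i|) atTop :=
        limsup_le_limsup (Eventually.of_forall fun n =>
          choquet_sum_grandMaximal_le hβ hβd hF n (c n) (h.1 n))
    _ = _ := ENNReal.limsup_const_mul_of_ne_top ENNReal.ofReal_ne_top

end DimStable

theorem mainTheorem3 (d : ℕ) :
    ∃ F₀ : Finset (ℕ × ℕ), ∀ β : ℝ, 0 < β → β ≤ d →
      ∃ C : ℝ, 0 < C ∧ ∀ F : Finset (ℕ × ℕ), F₀ ⊆ F → ∀ μ ∈ DimStable.DS d β,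
        DimStable.choquetIntegral β (DimStable.grandMaximal F ((d : ℝ) - β) μ) ≤
          ENNReal.ofReal C * DimStable.dsNorm β μ := by
  refine ⟨DimStable.testSeminorms d, fun β hβ hβd =>
    ⟨DimStable.omega β * ((d : ℝ) + 1) ^ β * DimStable.atomContentConst d β, ?_,
      fun F hF μ _ => ?_⟩⟩
  · have := DimStable.omega_pos hβ
    have := DimStable.atomConst_pos d β
    unfold DimStable.atomContentConst
    positivity
  · have hC : ENNReal.ofReal (DimStable.omega β * ((d : ℝ) + 1) ^ β *
        DimStable.atomContentConst d β) ≠ 0 := by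
      have := DimStable.omega_pos hβ
      have := DimStable.atomConst_pos d β
      rw [ne_eq, ENNReal.ofReal_eq_zero, not_le]
      unfold DimStable.atomContentConst
      positivity
    unfold DimStable.dsNorm
    -- A finite nonzero constant passes through the infimum, which reduces the claim to a fixed
    -- representation.
    rw [ENNReal.mul_iInf_of_ne hC ENNReal.ofReal_ne_top]
    refine le_iInf fun c => ?_
    rw [ENNReal.mul_iInf_of_ne hC ENNReal.ofReal_ne_top]
    refine le_iInf fun a => ?_
    rw [ENNReal.mul_iInf_of_ne hC ENNReal.ofReal_ne_top]
    exact le_iInf fun h => DimStable.choquetIntegral_grandMaximal_le hβ hβd hF h
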